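/- Let $\tau=\{0=\tau_0,\tau_1,\tau_2,\dots\}$ be a recurrent renewal process: $\tau_k$ is the sum of $k$ i.i.d. random variables distributed as $\tau_1$, with $\tau_1$ taking values in $\{1,2,3,\dots\}$ and $\mathbf P(\tau_1<\infty)=1$. Assume that $$\mathbf P(\tau_1=n)=\varphi(n)\,n^{-1}\qquad(n\ge 1),$$ where $\varphi$ is slowly varying: $\varphi$ is positive and measurable on some half-line $[X,\infty)$, and $\varphi(cx)/\varphi(x)\to1$ as $x\to\infty$ for every $c>0$. Write $r(x)=\mathbf P(\tau_1>x)$ for real $x$ and $r_n=r(n)$. Let $\varphi^*$ be any slowly varying function conjugate to $\varphi$ in the sense of de Bruijn, i.e. such that $g(x)=x\varphi^*(x)$ is an asymptotic inverse of $f(y)=y\varphi(y)$: $f(g(x))\sim x$ and $g(f(x))\sim x$ as $x\to\infty$. Let $n\ge k$. (i) For every $M>0$ there is a constant $a_M>0$, with $a_M\to1$ as $M\to0$, such that, if $n$ is large (depending on $M$) and $k\varphi(n)\le M$, then $$a_M(1-r_n)^k\le \mathbf P(\tau_k\le n)\le (1-r_n)^k .$$ (ii) If $k,n\to\infty$ with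 $k\varphi(n)\to\infty$ and $n/k\to\infty$, then $$\mathbf P(\tau_k\le n)=\exp\Big\{-(1+o(1))\,k\,r\Big(\tfrac nk\,\varphi^*\big(\tfrac nk\big)\Big)\Big\}.$$ (iii) For every real $b\ge1$ the limit $$-I(b)=\lim_{k\to\infty}\frac1k\log\mathbf P(\tau_k\le bk)$$ exists in $[-\infty,\infty]$ (with $\log 0=-\infty$), and it is finite if $b\ge\min\{j:\mathbf P(\tau_1=j)>0\}$. Moreover, $I(b)\sim r(b\varphi^*(b))$ as $b\to\infty$. -/

import Mathlib

open MeasureTheory ProbabilityTheory Filter Topology Asymptotics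

/-- `f` is slowly varying (at infinity): it is positive and measurable on some half-line `[X, ∞)`,
and `f (c x) / f x → 1` as `x → ∞`, for every `c > 0`. -/
def SlowlyVarying (f : ℝ → ℝ) : Prop :=
  (∃ X : ℝ, (∀ x, X ≤ x → 0 < f x) ∧ Measurable (fun x : Set.Ici X => f x)) ∧
    ∀ c : ℝ, 0 < c → Tendsto (fun x => f (c * x) / f x) atTop (𝓝 1)

/-- `g` is an asymptotic inverse of `f`: `f (g x) ∼ x` and `g (f x) ∼ x` as `x → ∞`. -/
def IsAsymptoticInverse (g f : ℝ → ℝ) : Prop :=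
  (fun x => f (g x)) ~[atTop] (fun x => x) ∧ (fun x => g (f x)) ~[atTop] (fun x => x)

/-- `ψ` is a (de Bruijn) conjugate of the slowly varying function `f`: it is slowly varying, and
`x ↦ x ψ(x)` is an asymptotic inverse of `y ↦ y f(y)`. -/
def IsDeBruijnConjugate (ψ f : ℝ → ℝ) : Prop :=
  SlowlyVarying ψ ∧ IsAsymptoticInverse (fun x => x * ψ x) (fun y => y * f y)

/-- The gaps of a recurrent renewal process: i.i.d. positive integer valued random variables.
Recurrence (`P (τ₁ = ∞) = 0`) is the fact that the gaps take finite values. -/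
structure IsRecurrentGapSequence {Ω : Type*} [MeasurableSpace Ω] (P : Measure Ω)
    (G : ℕ → Ω → ℕ) : Prop where
  measurable : ∀ i, Measurable (G i)
  pos : ∀ i, ∀ᵐ ω ∂P, 0 < G i ω
  indep : iIndepFun G P
  identDistrib : ∀ i, IdentDistrib (G i) (G 0) P P

/-- The renewal times `τ_k = G_0 + ⋯ + G_{k-1}` (so `τ_0 = 0`) of the renewal process with
gaps `G`. -/
def renewalTime {Ω : Type*} (G : ℕ → Ω → ℕ) (k : ℕ) (ω : Ω) : ℕ :=
  ∑ i ∈ Finset.range k, G i ω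

/-- The tail `r(x) = P (τ₁ > x)` of the inter-arrival distribution, for real `x`. -/
noncomputable def renewalTail {Ω : Type*} [MeasurableSpace Ω] (P : Measure Ω)
    (G : ℕ → Ω → ℕ) (x : ℝ) : ℝ :=
  P.real {ω | x < (renewalTime G 1 ω : ℝ)}

/-!
Write `r` for the tail of the gaps, `A(x) = ∑_{1 ≤ j ≤ x} φ(j)` for their truncated mean
`E[τ₁; τ₁ ≤ x]`, and `m = b φ*(b)`, so that `m φ(m) ∼ b`. Three facts about the law are needed.

* `φ` is almost constant on `[x, 2x]` for large `x` (`SlowlyVarying.eventually_forall_Icc`, from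
  the uniform convergence theorem `eventually_forall_abs_sub_lt`).
* Hence `r(x) - r(2x)` is comparable to `φ(x)`. Adding this over many dyadic scales, `φ = o(r)`
  (`tendsto_div_tail`), so that `r(2 ^ i x) ∼ r(x)` for every integer `i`.
* `A(x) = O(x φ(x))` (`exists_eventually_partialSum_le`).

Probability enters through three bounds on `P(τ_k ≤ t)`, each obtained by comparing the indicator
of `{τ_k ≤ t}` with products of functions of the independent gaps:

* no gap exceeds `t`, so `P(τ_k ≤ t) ≤ (1 - r(t)) ^ k` (`prob_le_one_sub_tail_pow`);
* the exponential Markov inequality, where the Laplace transform of a gap is bounded by that of a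
  two-valued variable, gives `P(τ_k ≤ t) ≤ exp(λ t - k (1 - e^{-λ y}) r(y))` (`prob_le_exp`);
* asking that no gap exceeds `y` and applying Markov's inequality to the truncated sum gives
  `P(τ_k ≤ t) ≥ q ^ k (1 - k A(y) / (t q))` with `q = 1 - r(y)` (`le_prob`).

When `k φ(n) ≤ M`, the upper bound is the first of these. The lower bound is the third one at
`y = n / 2 ^ i`, with `i` so large (depending on `M`) that the Markov term is at most `1 / 2`.
Replacing `r(y)` by `r(n)` costs a bounded factor, because `r(y) - r(n) = O(i φ(n))` and
`k φ(n) ≤ M`. For small `M` one can take `i = 0`, whence `a_M → 1`.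

For `n / k → ∞`, and for the rate function, take `t = b k`. The second bound at `λ = 1 / m`,
`y = 2 ^ i m` has `λ t = k b / m ∼ k φ(m) = o(k r(m))`, and the third one at `y = m / 2 ^ l` has a
Markov term of order `2 ^ (-l)`. As `r(2 ^ i m) ∼ r(m / 2 ^ l) ∼ r(m)`, both bounds are
`exp(-(1 ± δ) k r(m))` up to a factor `1 / 2`, for all `k` and all large `b`
(`eventually_prob_bounds`). If `k φ(n) → ∞`, that factor is negligible as `k r(m) → ∞`. For the
rate function it disappears on dividing the logarithm by `k`; the limit exists by Fekete's lemma,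
as `P(τ_{k+l} ≤ b (k+l)) ≥ P(τ_k ≤ b k) P(τ_l ≤ b l)`, and is `-∞` if `b` is below the least value
of a gap.
-/

/-! ### Uniform convergence for slowly varying functions -/

theorem min_one_abs_sub_le (a b c : ℝ) :
    min 1 |a - b| ≤ min 1 |c - b| + min 1 |c - a| := by
  have h := abs_sub_le a c b
  rw [abs_sub_comm a c] at h
  rcases le_total 1 |c - b| with h1 | h1 <;> rcases le_total 1 |c - a| with h2 | h2 <;>
    simp only [min_eq_left, min_eq_right, h1, h2] <;>
    first
    | linarith [min_le_left 1 |a - b|, abs_nonneg (c - a), abs_nonneg (c - b)]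
    | linarith [min_le_right 1 |a - b|]

theorem intervalIntegrable_min_one {f : ℝ → ℝ} (hf : Measurable f) (a b : ℝ) :
    IntervalIntegrable (fun v => min 1 |f v|) volume a b := by
  have hm : Measurable (fun v => min 1 |f v|) := measurable_const.min hf.abs
  refine (intervalIntegrable_const (c := (1 : ℝ))).mono_fun hm.aestronglyMeasurable ?_
  refine Eventually.of_forall fun v => ?_
  simp [abs_of_nonneg (le_min zero_le_one (abs_nonneg (f v)))]

/-- The **uniform convergence theorem** in additive form. The pointwise hypothesis is averaged:
`F(x) = ∫₀² min(1, |h(x + v) - h(x)|) dv` tends to `0` by dominated convergence. For `u ∈ [0, 1]`,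
comparing `h(x + u)` and `h(x)` through `h(x + v)` and averaging over `v ∈ [1, 2]` bounds
`min(1, |h(x + u) - h(x)|)` by `F(x) + F(x + u)`, whatever `u` is. -/
theorem eventually_forall_abs_sub_lt {h : ℝ → ℝ} (hm : Measurable h)
    (hh : ∀ u, Tendsto (fun x => h (x + u) - h x) atTop (𝓝 0)) {η : ℝ} (hη : 0 < η) :
    ∀ᶠ x in atTop, ∀ u ∈ Set.Icc (0 : ℝ) 1, |h (x + u) - h x| < η := by
  set F : ℝ → ℝ := fun x => ∫ v in (0 : ℝ)..2, min 1 |h (x + v) - h x| with hF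
  have hmeas : ∀ x y, Measurable (fun v => h (x + v) - h y) := fun x y =>
    (hm.comp (measurable_const_add x)).sub_const _
  have hF0 : Tendsto F atTop (𝓝 0) := by
    have : Tendsto F atTop (𝓝 (∫ v in (0 : ℝ)..2, (0 : ℝ))) := by
      refine intervalIntegral.tendsto_integral_filter_of_dominated_convergence (fun _ => (1 : ℝ))
        (Eventually.of_forall fun x => ?_) (Eventually.of_forall fun x => ?_)
        intervalIntegrable_const ?_
      · exact (measurable_const.min (hmeas x x).abs).aestronglyMeasurable
      · refine Eventually.of_forall fun v _ => ?_
        rw [Real.norm_eq_abs, abs_of_nonneg (le_min zero_le_one (abs_nonneg _))]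
        exact min_le_left _ _
      · refine Eventually.of_forall fun v _ => ?_
        have := (tendsto_const_nhds (x := (1 : ℝ))).min (hh v).abs
        simpa using this
    simpa using this
  set η' := min η 1 with hη'
  have hη'0 : 0 < η' := lt_min hη one_pos
  obtain ⟨X, hX⟩ := eventually_atTop.1 (hF0.eventually_lt_const (half_pos hη'0))
  filter_upwards [eventually_ge_atTop X] with x hx u hu
  have key : min 1 |h (x + u) - h x| ≤ F x + F (x + u) := by
    have e1 : min 1 |h (x + u) - h x| =
        ∫ v in (1 : ℝ)..2, min 1 |h (x + u) - h x| := by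
      rw [intervalIntegral.integral_const]; norm_num
    have nn : ∀ y z : ℝ, 0 ≤ᵐ[volume.restrict (Set.Ioc (0 : ℝ) 2)]
        fun v => min 1 |h (y + v) - h z| := fun y z =>
      Eventually.of_forall fun v => le_min zero_le_one (abs_nonneg _)
    have e2 : ∫ v in (1 : ℝ)..2, min 1 |h (x + v) - h x| ≤ F x :=
      intervalIntegral.integral_mono_interval (by norm_num) (by norm_num) le_rfl (nn x x)
        (intervalIntegrable_min_one (hmeas x x) _ _)
    have e3 : ∫ v in (1 : ℝ)..2, min 1 |h (x + v) - h (x + u)| ≤ F (x + u) := by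
      have : ∫ v in (1 : ℝ)..2, min 1 |h (x + v) - h (x + u)| =
          ∫ v in (1 - u)..(2 - u), min 1 |h (x + u + v) - h (x + u)| := by
        rw [← intervalIntegral.integral_comp_sub_right
          (fun v => min 1 |h (x + u + v) - h (x + u)|) u]
        refine intervalIntegral.integral_congr fun v _ => ?_
        simp only [add_assoc, add_sub_cancel]
      rw [this]
      exact intervalIntegral.integral_mono_interval (by linarith [hu.2]) (by linarith)
        (by linarith [hu.1]) (nn _ _) (intervalIntegrable_min_one (hmeas _ _) _ _)
    rw [e1]
    refine le_trans ?_ (add_le_add e2 e3)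
    rw [← intervalIntegral.integral_add (intervalIntegrable_min_one (hmeas _ _) _ _)
      (intervalIntegrable_min_one (hmeas _ _) _ _)]
    refine intervalIntegral.integral_mono_on (by norm_num) intervalIntegrable_const
      ((intervalIntegrable_min_one (hmeas _ _) _ _).add
        (intervalIntegrable_min_one (hmeas _ _) _ _)) fun v _ => ?_
    exact min_one_abs_sub_le _ _ _
  have h1 := hX x hx
  have h2 := hX (x + u) (by linarith [hu.1])
  have h3 : min 1 |h (x + u) - h x| < η' := by linarith
  rcases min_lt_iff.1 h3 with h4 | h4
  · exact absurd h4 (not_lt.2 (min_le_right _ _))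
  · exact h4.trans_le (min_le_left _ _)

namespace SlowlyVarying

variable {f : ℝ → ℝ}

theorem eventually_pos (hf : SlowlyVarying f) : ∀ᶠ x in atTop, 0 < f x := by
  obtain ⟨⟨X, hX, -⟩, -⟩ := hf
  exact eventually_atTop.2 ⟨X, hX⟩

theorem tendsto_div (hf : SlowlyVarying f) {c : ℝ} (hc : 0 < c) :
    Tendsto (fun x => f (c * x) / f x) atTop (𝓝 1) := hf.2 c hc

/-- The uniform convergence theorem on the window `[x, 2x]`, with explicit constants. -/
theorem eventually_forall_Icc (hf : SlowlyVarying f) :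
    ∀ᶠ x in atTop, ∀ y, x ≤ y → y ≤ 2 * x → 3 / 4 * f x ≤ f y ∧ f y ≤ 2 * f x := by
  obtain ⟨⟨X, hX, hXm⟩, hlim⟩ := hf
  -- Truncating the argument at `X` makes the function measurable on the whole line.
  set h : ℝ → ℝ := fun t => Real.log (f (max X (Real.exp t))) with hh
  have hm : Measurable h := by
    have : Measurable
        (fun t : ℝ => (⟨max X (Real.exp t), le_max_left X (Real.exp t)⟩ : Set.Ici X)) :=
      (measurable_const.max Real.measurable_exp).subtype_mk
        (h := fun t => le_max_left X (Real.exp t))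
    exact Real.measurable_log.comp (hXm.comp this)
  have hlim' : ∀ u, Tendsto (fun x => h (x + u) - h x) atTop (𝓝 0) := by
    intro u
    have h1 := ((hlim (Real.exp u) (Real.exp_pos u)).comp Real.tendsto_exp_atTop).log one_ne_zero
    rw [Real.log_one] at h1
    refine h1.congr' ?_
    filter_upwards [Real.tendsto_exp_atTop.eventually_ge_atTop X,
      (Real.tendsto_exp_atTop.comp
        (tendsto_atTop_add_const_right atTop u tendsto_id)).eventually_ge_atTop X]
      with t h2 h3
    simp only [Function.comp, id] at h3 ⊢
    simp only [hh, max_eq_right h2, max_eq_right h3]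
    rw [← Real.exp_add, add_comm u t, Real.log_div (hX _ h3).ne' (hX _ h2).ne']
  have hη : 0 < Real.log (4 / 3) := Real.log_pos (by norm_num)
  filter_upwards [Real.tendsto_log_atTop.eventually (eventually_forall_abs_sub_lt hm hlim' hη),
    eventually_ge_atTop X, eventually_gt_atTop 0] with x hx hxX hx0 y hxy hyx
  have hy0 : 0 < y := hx0.trans_le hxy
  -- In logarithmic coordinates the window has length `log 2 < 1`.
  have h2 := hx (Real.log y - Real.log x) ⟨sub_nonneg.2 (Real.log_le_log hx0 hxy), by
    rw [← Real.log_div hy0.ne' hx0.ne']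
    have : y / x ≤ 2 := by rw [div_le_iff₀ hx0]; exact hyx
    have := Real.log_le_log (div_pos hy0 hx0) this
    linarith [Real.log_two_lt_d9]⟩
  simp only [hh, add_sub_cancel, Real.exp_log hx0, Real.exp_log hy0, max_eq_right hxX,
    max_eq_right (hxX.trans hxy)] at h2
  have fx := hX x hxX
  have fy := hX y (hxX.trans hxy)
  rw [← Real.log_div fy.ne' fx.ne', abs_lt, ← Real.log_inv,
    Real.log_lt_log_iff (by norm_num) (div_pos fy fx),
    Real.log_lt_log_iff (div_pos fy fx) (by norm_num), div_lt_iff₀ fx, lt_div_iff₀ fx] at h2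
  norm_num at h2
  constructor <;> linarith [h2.1, h2.2]

end SlowlyVarying

/-! ### Dyadic growth, and sums of a slowly varying function -/

/-- Induction along doublings, starting from the window `[X, 2X]`. -/
theorem dyadic_induction {p : ℝ → Prop} {X : ℝ} (hX : 0 < X)
    (base : ∀ x, X ≤ x → x ≤ 2 * X → p x) (step : ∀ x, X ≤ x → p x → p (2 * x))
    {x : ℝ} (hx : X ≤ x) : p x := by
  have key : ∀ n : ℕ, ∀ x, X ≤ x → x ≤ 2 ^ (n + 1) * X → p x := by
    intro n
    induction n with
    | zero => intro x h1 h2; exact base x h1 (by simpa using h2)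
    | succ n ih =>
      intro x h1 h2
      rcases le_total x (2 * X) with h3 | h3
      · exact base x h1 h3
      · have := step (x / 2) (by linarith) (ih (x / 2) (by linarith) (by
          rw [pow_succ] at h2; linarith))
        rwa [mul_div_cancel₀ _ (two_ne_zero)] at this
  obtain ⟨n, hn⟩ := pow_unbounded_of_one_lt (x / X) (one_lt_two (α := ℝ))
  refine key n x hx ?_
  rw [div_lt_iff₀ hX] at hn
  have : (2 : ℝ) ^ n * X ≤ 2 ^ (n + 1) * X := by
    gcongr <;> norm_num
  linarith

/-- The function `x ↦ x f(x)` grows by a factor at least `3 / 2` at each doubling of `x`. -/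
theorem SlowlyVarying.tendsto_mul_atTop {f : ℝ → ℝ} (hf : SlowlyVarying f) :
    Tendsto (fun x => x * f x) atTop atTop := by
  obtain ⟨X, hX⟩ := eventually_atTop.1
    ((hf.eventually_forall_Icc.and hf.eventually_pos).and (eventually_ge_atTop 1))
  have hX1 : 1 ≤ X := (hX X le_rfl).2
  have hX0 : 0 < X := by linarith
  have hc : 0 < 3 / 4 * (X * f X) := by have := (hX X le_rfl).1.2; positivity
  set c := 3 / 4 * (X * f X) with hcdef
  have hstep : ∀ x, X ≤ x → 3 / 2 * (x * f x) ≤ 2 * x * f (2 * x) := fun x hx => by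
    have hx0 : 0 < x := by linarith
    have := mul_le_mul_of_nonneg_left ((hX x hx).1.1 (2 * x) (by linarith) le_rfl).1 hx0.le
    linarith
  have key : ∀ n : ℕ, ∀ x, 2 ^ n * X ≤ x → c * (3 / 2) ^ n ≤ x * f x := by
    intro n
    induction n with
    | zero =>
      intro x hx
      rw [pow_zero, mul_one]
      refine dyadic_induction (p := fun x => c ≤ x * f x) hX0 (fun x h1 h2 => ?_)
        (fun x h1 h2 => ?_) (by simpa using hx)
      · have h3 := ((hX X le_rfl).1.1 x h1 h2).1
        have := mul_le_mul h1 h3 (by have := (hX X le_rfl).1.2; positivity) (by linarith)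
        linarith
      · linarith [hstep x h1]
    | succ n ih =>
      intro x hx
      rw [pow_succ] at hx
      have h1 : 2 ^ n * X ≤ x / 2 := by linarith
      have h2 : X ≤ 2 ^ n * X := le_mul_of_one_le_left hX0.le (one_le_pow₀ one_le_two)
      have h3 := hstep (x / 2) (h2.trans h1)
      rw [mul_div_cancel₀ x two_ne_zero] at h3
      have h4 := ih _ h1
      rw [pow_succ]
      linarith
  refine tendsto_atTop.2 fun B => ?_
  obtain ⟨n, hn⟩ := pow_unbounded_of_one_lt (B / c) (by norm_num : (1 : ℝ) < 3 / 2)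
  rw [div_lt_iff₀ hc] at hn
  filter_upwards [eventually_ge_atTop (2 ^ n * X)] with x hx
  linarith [key n x hx]

theorem card_Ioc_floor_bounds {x : ℝ} (hx : 0 ≤ x) :
    x - 1 ≤ ((Finset.Ioc ⌊x⌋₊ ⌊2 * x⌋₊).card : ℝ) ∧
      ((Finset.Ioc ⌊x⌋₊ ⌊2 * x⌋₊).card : ℝ) ≤ x + 1 := by
  have h : ⌊x⌋₊ ≤ ⌊2 * x⌋₊ := Nat.floor_le_floor (by linarith)
  rw [Nat.card_Ioc, Nat.cast_sub h]
  have h1 := Nat.floor_le hx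
  have h2 := Nat.floor_le (show 0 ≤ 2 * x by linarith)
  have h3 := Nat.lt_floor_add_one x
  have h4 := Nat.lt_floor_add_one (2 * x)
  constructor <;> linarith

/-- The window `(x, 2x]` contains between `x / 2` and `2x` integers, if `x ≥ 2`. -/
theorem sum_Ioc_floor_bounds {x a b : ℝ} (hx : 2 ≤ x) (ha : 0 ≤ a) {u : ℕ → ℝ}
    (hu : ∀ j : ℕ, x ≤ j → (j : ℝ) ≤ 2 * x → a ≤ u j ∧ u j ≤ b) :
    x / 2 * a ≤ ∑ j ∈ Finset.Ioc ⌊x⌋₊ ⌊2 * x⌋₊, u j ∧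
      ∑ j ∈ Finset.Ioc ⌊x⌋₊ ⌊2 * x⌋₊, u j ≤ 2 * x * b := by
  have hx0 : 0 ≤ x := by linarith
  have hmem : ∀ j ∈ Finset.Ioc ⌊x⌋₊ ⌊2 * x⌋₊, a ≤ u j ∧ u j ≤ b := fun j hj => by
    rw [Finset.mem_Ioc, Nat.floor_lt hx0, Nat.le_floor_iff (by linarith)] at hj
    exact hu j hj.1.le hj.2
  obtain ⟨c1, c2⟩ := card_Ioc_floor_bounds hx0
  have s1 := Finset.card_nsmul_le_sum _ u a fun j hj => (hmem j hj).1
  have s2 := Finset.sum_le_card_nsmul _ u b fun j hj => (hmem j hj).2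
  have hb : 0 ≤ b := by
    have hne : (Finset.Ioc ⌊x⌋₊ ⌊2 * x⌋₊).Nonempty := by
      rw [← Finset.card_pos]
      have : (0 : ℝ) < (Finset.Ioc ⌊x⌋₊ ⌊2 * x⌋₊).card := by linarith
      exact_mod_cast this
    obtain ⟨j, hj⟩ := hne
    exact ha.trans ((hmem j hj).1.trans (hmem j hj).2)
  rw [nsmul_eq_mul] at s1 s2
  exact ⟨(mul_le_mul_of_nonneg_right (by linarith) ha).trans s1,
    s2.trans (mul_le_mul_of_nonneg_right (by linarith) hb)⟩

/-- The sum `∑_{1 ≤ j ≤ x} φ(j)`, for real `x`. It is the mean `E[τ₁; τ₁ ≤ x]` of the truncated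
gap when `P(τ₁ = j) = φ(j) / j`. -/
noncomputable def partialSum (φ : ℝ → ℝ) (x : ℝ) : ℝ := ∑ j ∈ Finset.Ioc 0 ⌊x⌋₊, φ j

section PartialSum

variable {φ : ℝ → ℝ}

theorem partialSum_nonneg (hφ0 : ∀ j : ℕ, 1 ≤ j → 0 ≤ φ j) (x : ℝ) : 0 ≤ partialSum φ x :=
  Finset.sum_nonneg fun j hj => hφ0 j (Finset.mem_Ioc.1 hj).1

theorem partialSum_mono (hφ0 : ∀ j : ℕ, 1 ≤ j → 0 ≤ φ j) : Monotone (partialSum φ) := by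
  intro x y hxy
  refine Finset.sum_le_sum_of_subset_of_nonneg
    (Finset.Ioc_subset_Ioc le_rfl (Nat.floor_le_floor hxy)) fun j hj _ => ?_
  exact hφ0 j (Finset.mem_Ioc.1 hj).1

theorem partialSum_two_mul_sub {x : ℝ} (hx : 0 ≤ x) : partialSum φ (2 * x) - partialSum φ x =
    ∑ j ∈ Finset.Ioc ⌊x⌋₊ ⌊2 * x⌋₊, φ j := by
  have h : ⌊x⌋₊ ≤ ⌊2 * x⌋₊ := Nat.floor_le_floor (by linarith)
  rw [partialSum, partialSum, sub_eq_iff_eq_add', Finset.sum_Ioc_consecutive _ (Nat.zero_le _) h]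

theorem eventually_partialSum_two_mul_sub (hφ : SlowlyVarying φ) :
    ∀ᶠ x in atTop, x * φ x / 4 ≤ partialSum φ (2 * x) - partialSum φ x ∧
      partialSum φ (2 * x) - partialSum φ x ≤ 4 * (x * φ x) := by
  filter_upwards [hφ.eventually_forall_Icc, hφ.eventually_pos, eventually_ge_atTop 2]
    with x h1 h2 h3
  rw [partialSum_two_mul_sub (by linarith)]
  obtain ⟨s1, s2⟩ := sum_Ioc_floor_bounds (u := fun j : ℕ => φ j) h3 (by positivity)
    fun j hj hj' => h1 j hj hj'
  have : 0 < x * φ x := by positivity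
  constructor <;> linarith

/-- The upper half of Karamata's theorem, up to the constant. From `x` to `2x` the sum increases
by at most `4 x φ(x)`, while `x φ(x)` grows by a factor at least `3 / 2`; this propagates the
bound as soon as `C ≥ 8`. -/
theorem exists_eventually_partialSum_le (hφ : SlowlyVarying φ)
    (hφ0 : ∀ j : ℕ, 1 ≤ j → 0 ≤ φ j) :
    ∃ C : ℝ, 0 < C ∧ ∀ᶠ x in atTop, partialSum φ x ≤ C * (x * φ x) := by
  obtain ⟨X, hX⟩ := eventually_atTop.1 (((hφ.eventually_forall_Icc.and hφ.eventually_pos).and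
    (eventually_partialSum_two_mul_sub hφ)).and (eventually_ge_atTop 1))
  have hX1 : 1 ≤ X := (hX X le_rfl).2
  have hX0 : 0 < X := by linarith
  have hc : 0 < X * (3 / 4 * φ X) := by have := (hX X le_rfl).1.1.2; positivity
  set c := X * (3 / 4 * φ X) with hcdef
  set C := max 8 (partialSum φ (2 * X) / c) with hC
  have hC8 : 8 ≤ C := le_max_left _ _
  refine ⟨C, by linarith, ?_⟩
  filter_upwards [eventually_ge_atTop X] with x hx
  refine dyadic_induction (p := fun x => partialSum φ x ≤ C * (x * φ x)) hX0
    (fun x h1 h2 => ?_) (fun x h1 h2 => ?_) hx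
  · have h3 := ((hX X le_rfl).1.1.1 x h1 h2).1
    have h4 : c ≤ x * φ x := mul_le_mul h1 h3
      (by have := (hX X le_rfl).1.1.2; positivity) (by linarith)
    have h5 : partialSum φ (2 * X) / c ≤ C := le_max_right _ _
    rw [div_le_iff₀ hc] at h5
    calc partialSum φ x ≤ partialSum φ (2 * X) := partialSum_mono hφ0 h2
      _ ≤ C * c := h5
      _ ≤ C * (x * φ x) := mul_le_mul_of_nonneg_left h4 (by linarith)
  · have h3 := (hX x h1).1.2.2
    have h4 := ((hX x h1).1.1.1 (2 * x) (by linarith) le_rfl).1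
    have hx0 : 0 < x := by linarith
    have hpos : 0 < x * φ x := mul_pos hx0 (hX x h1).1.1.2
    have h5 : 3 / 2 * (x * φ x) ≤ 2 * x * φ (2 * x) := by
      have := mul_le_mul_of_nonneg_left h4 hx0.le
      linarith
    have h6 := mul_le_mul_of_nonneg_left h5 (by linarith : 0 ≤ C)
    have h7 : 8 * (x * φ x) ≤ C * (x * φ x) := mul_le_mul_of_nonneg_right hC8 hpos.le
    linarith

theorem eventually_le_partialSum (hφ : SlowlyVarying φ) (hφ0 : ∀ j : ℕ, 1 ≤ j → 0 ≤ φ j) :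
    ∀ᶠ x in atTop, x * φ x / 16 ≤ partialSum φ x := by
  have ht : Tendsto (fun x : ℝ => x / 2) atTop atTop := tendsto_id.atTop_div_const two_pos
  filter_upwards [ht.eventually (eventually_partialSum_two_mul_sub hφ),
    ht.eventually hφ.eventually_forall_Icc, eventually_ge_atTop 0] with x h1 h2 h3
  have h4 := (h2 x (by linarith) (by linarith)).2
  rw [mul_div_cancel₀ x two_ne_zero] at h1
  have h5 := mul_le_mul_of_nonneg_left h4 h3
  linarith [h1.1, partialSum_nonneg hφ0 (x / 2)]

end PartialSum

section Tail

variable {φ r : ℝ → ℝ}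

theorem eventually_tail_sub (hφ : SlowlyVarying φ)
    (hr : ∀ x y, 0 ≤ x → x ≤ y → r x - r y = ∑ j ∈ Finset.Ioc ⌊x⌋₊ ⌊y⌋₊, φ j / j) :
    ∀ᶠ x in atTop, φ x / 8 ≤ r x - r (2 * x) ∧ r x - r (2 * x) ≤ 4 * φ x := by
  filter_upwards [hφ.eventually_forall_Icc, hφ.eventually_pos, eventually_ge_atTop 2]
    with x h1 h2 h3
  have hx : 0 < x := by linarith
  rw [hr x (2 * x) (by linarith) (by linarith)]
  obtain ⟨s1, s2⟩ := sum_Ioc_floor_bounds (u := fun j : ℕ => φ j / j) (a := 3 / 4 * φ x / (2 * x))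
    (b := 2 * φ x / x) h3 (by positivity) fun j hj hj' => by
      obtain ⟨h4, h5⟩ := h1 j hj hj'
      have hj0 : (0 : ℝ) < j := by linarith
      exact ⟨div_le_div₀ (by linarith) h4 hj0 hj', div_le_div₀ (by positivity) h5 hx hj⟩
  have e1 : x / 2 * (3 / 4 * φ x / (2 * x)) = 3 / 16 * φ x := by field_simp; ring
  have e2 : 2 * x * (2 * φ x / x) = 4 * φ x := by field_simp; ring
  constructor <;> linarith

theorem eventually_tail_pos (hφ : SlowlyVarying φ) (hr0 : ∀ x, 0 ≤ r x)
    (hr : ∀ x y, 0 ≤ x → x ≤ y → r x - r y = ∑ j ∈ Finset.Ioc ⌊x⌋₊ ⌊y⌋₊, φ j / j) :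
    ∀ᶠ x in atTop, 0 < r x := by
  filter_upwards [eventually_tail_sub hφ hr, hφ.eventually_pos] with x h1 h2
  linarith [hr0 (2 * x), h1.1]

/-- `φ(x)` is negligible with respect to `r(x)`: each of the first `N` dyadic windows above `x`
contributes at least `φ(x) / 16` to `r(x)`, with `N` arbitrary. -/
theorem tendsto_div_tail (hφ : SlowlyVarying φ) (hr0 : ∀ x, 0 ≤ r x)
    (hr : ∀ x y, 0 ≤ x → x ≤ y → r x - r y = ∑ j ∈ Finset.Ioc ⌊x⌋₊ ⌊y⌋₊, φ j / j) :
    Tendsto (fun x => φ x / r x) atTop (𝓝 0) := by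
  have key : ∀ N : ℕ, ∀ᶠ x in atTop, N * φ x / 16 ≤ r x - r (2 ^ N * x) := by
    intro N
    induction N with
    | zero => simp
    | succ N ih =>
      have ht : Tendsto (fun x : ℝ => 2 ^ N * x) atTop atTop :=
        tendsto_id.const_mul_atTop (by positivity)
      have hlim := (hφ.tendsto_div (c := 2 ^ N) (by positivity)).eventually_const_le
        (by norm_num : (1 / 2 : ℝ) < 1)
      filter_upwards [ih, hlim, hφ.eventually_pos, ht.eventually (eventually_tail_sub hφ hr)]
        with x h1 h2 h3 h4
      rw [le_div_iff₀ h3] at h2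
      rw [pow_succ', mul_assoc]
      push_cast
      linarith [h4.1]
  rw [Metric.tendsto_atTop']
  intro η hη
  obtain ⟨N, hN⟩ := exists_nat_gt (16 / η)
  have hev := ((key N).and hφ.eventually_pos).and (eventually_tail_pos hφ hr0 hr)
  obtain ⟨X, hX⟩ := eventually_atTop.1 hev
  refine ⟨X, fun x hx => ?_⟩
  obtain ⟨⟨h1, h2⟩, h3⟩ := hX x hx.le
  rw [Real.dist_eq, sub_zero, abs_of_pos (by positivity), div_lt_iff₀ h3]
  rw [div_lt_iff₀ hη] at hN
  have h4 := mul_lt_mul_of_pos_right hN h2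
  have h5 := mul_le_mul_of_nonneg_left (h1.trans (sub_le_self _ (hr0 _))) hη.le
  linarith

theorem tendsto_tail_two_pow_mul (hφ : SlowlyVarying φ) (hr0 : ∀ x, 0 ≤ r x)
    (hr : ∀ x y, 0 ≤ x → x ≤ y → r x - r y = ∑ j ∈ Finset.Ioc ⌊x⌋₊ ⌊y⌋₊, φ j / j) (i : ℕ) :
    Tendsto (fun x => r (2 ^ i * x) / r x) atTop (𝓝 1) := by
  have hpos := eventually_tail_pos hφ hr0 hr
  have two : Tendsto (fun x => r (2 * x) / r x) atTop (𝓝 1) := by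
    have h1 : Tendsto (fun x => 1 - 4 * (φ x / r x)) atTop (𝓝 1) := by
      simpa using ((tendsto_div_tail hφ hr0 hr).const_mul 4).const_sub 1
    refine tendsto_of_tendsto_of_tendsto_of_le_of_le' h1 tendsto_const_nhds ?_ ?_
    · filter_upwards [eventually_tail_sub hφ hr, hpos] with x h2 h3
      rw [le_div_iff₀ h3, sub_mul, mul_assoc, div_mul_cancel₀ _ h3.ne']
      linarith [h2.2]
    · filter_upwards [eventually_tail_sub hφ hr, hpos, hφ.eventually_pos] with x h2 h3 h4
      rw [div_le_one h3]
      linarith [h2.1]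
  induction i with
  | zero =>
    refine tendsto_const_nhds.congr' ?_
    filter_upwards [hpos] with x hx
    rw [pow_zero, one_mul, div_self hx.ne']
  | succ i ih =>
    have ht : Tendsto (fun x : ℝ => 2 ^ i * x) atTop atTop :=
      tendsto_id.const_mul_atTop (by positivity)
    have h := (two.comp ht).mul ih
    rw [one_mul] at h
    refine h.congr' ?_
    filter_upwards [ht.eventually hpos] with x hx
    simp only [Function.comp]
    rw [div_mul_div_cancel₀ hx.ne', pow_succ', mul_assoc]

theorem tendsto_tail_div_two_pow (hφ : SlowlyVarying φ) (hr0 : ∀ x, 0 ≤ r x)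
    (hr : ∀ x y, 0 ≤ x → x ≤ y → r x - r y = ∑ j ∈ Finset.Ioc ⌊x⌋₊ ⌊y⌋₊, φ j / j) (i : ℕ) :
    Tendsto (fun x => r (x / 2 ^ i) / r x) atTop (𝓝 1) := by
  have ht : Tendsto (fun x : ℝ => x / 2 ^ i) atTop atTop :=
    tendsto_id.atTop_div_const (by positivity)
  have h := ((tendsto_tail_two_pow_mul hφ hr0 hr i).comp ht).inv₀ one_ne_zero
  rw [inv_one] at h
  refine h.congr fun x => ?_
  simp only [Function.comp]
  rw [inv_div, mul_div_cancel₀ _ (by positivity)]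

theorem eventually_tail_div_two_pow_le (hφ : SlowlyVarying φ)
    (hr : ∀ x y, 0 ≤ x → x ≤ y → r x - r y = ∑ j ∈ Finset.Ioc ⌊x⌋₊ ⌊y⌋₊, φ j / j) (i : ℕ) :
    ∀ᶠ x in atTop, r (x / 2 ^ i) ≤ r x + 8 * i * φ x := by
  induction i with
  | zero => simp
  | succ i ih =>
    have ht : Tendsto (fun x : ℝ => x / 2 ^ (i + 1)) atTop atTop :=
      tendsto_id.atTop_div_const (by positivity)
    have hlim := (hφ.tendsto_div (c := (2 ^ (i + 1))⁻¹) (by positivity)).eventually_le_const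
      (by norm_num : (1 : ℝ) < 2)
    filter_upwards [ih, ht.eventually (eventually_tail_sub hφ hr), hlim, hφ.eventually_pos]
      with x h1 h2 h3 h4
    rw [inv_mul_eq_div, div_le_iff₀ h4] at h3
    have e : 2 * (x / 2 ^ (i + 1)) = x / 2 ^ i := by rw [pow_succ]; field_simp
    rw [e] at h2
    push_cast
    linarith [h2.2]

end Tail

/-! ### Renewal times: bounds for finitely many gaps -/

theorem renewalTime_one {Ω : Type*} (G : ℕ → Ω → ℕ) : renewalTime G 1 = G 0 := by
  funext ω
  simp [renewalTime]

theorem gap_le_renewalTime {Ω : Type*} (G : ℕ → Ω → ℕ) {k i : ℕ} (hi : i ∈ Finset.range k) (ω : Ω) :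
    G i ω ≤ renewalTime G k ω :=
  Finset.single_le_sum (f := fun i => G i ω) (fun _ _ => Nat.zero_le _) hi

namespace IsRecurrentGapSequence

variable {Ω : Type*} [MeasurableSpace Ω] {P : Measure Ω} {G : ℕ → Ω → ℕ}

theorem measurable_comp (hG : IsRecurrentGapSequence P G) (i : ℕ) (f : ℕ → ℝ) :
    Measurable (fun ω => f (G i ω)) :=
  (measurable_of_countable f).comp (hG.measurable i)

theorem measurable_renewalTime (hG : IsRecurrentGapSequence P G) (k : ℕ) :
    Measurable (renewalTime G k) := by
  unfold renewalTime
  exact Finset.measurable_sum _ fun i _ => hG.measurable i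

theorem measurableSet_renewalTime (hG : IsRecurrentGapSequence P G) (k : ℕ) (s : Set ℕ) :
    MeasurableSet {ω | renewalTime G k ω ∈ s} :=
  hG.measurable_renewalTime k (MeasurableSet.of_discrete)

theorem measurableSet_gap (hG : IsRecurrentGapSequence P G) (s : Set ℕ) :
    MeasurableSet {ω | G 0 ω ∈ s} :=
  hG.measurable 0 (MeasurableSet.of_discrete)

/-- Expectations of products of functions of the gaps, by independence. -/
theorem integral_prod (hG : IsRecurrentGapSequence P G) (k : ℕ) (f : ℕ → ℕ → ℝ) :
    ∫ ω, ∏ i ∈ Finset.range k, f i (G i ω) ∂P =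
      ∏ i ∈ Finset.range k, ∫ ω, f i (G 0 ω) ∂P := by
  simp_rw [Finset.prod_range]
  have hind : iIndepFun (fun (i : Fin k) ω => f i (G i ω)) P :=
    (hG.indep.precomp Fin.val_injective).comp (fun i => f i) fun i => measurable_of_countable _
  rw [hind.integral_fun_prod_eq_prod_integral fun i =>
    (hG.measurable_comp i (f i)).aestronglyMeasurable]
  refine Finset.prod_congr rfl fun i _ => ?_
  exact ((hG.identDistrib i).comp (measurable_of_countable (f i))).integral_eq

theorem measurable_prod (hG : IsRecurrentGapSequence P G) (k : ℕ) (f : ℕ → ℝ) :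
    Measurable (fun ω => ∏ i ∈ Finset.range k, f (G i ω)) :=
  Finset.measurable_fun_prod _ fun i _ => hG.measurable_comp i f

theorem tail_eq (x : ℝ) : renewalTail P G x = P.real {ω | x < (G 0 ω : ℝ)} := by
  rw [renewalTail, renewalTime_one]

theorem tail_nonneg (x : ℝ) : 0 ≤ renewalTail P G x := measureReal_nonneg

variable [IsProbabilityMeasure P]

theorem tail_anti : Antitone (renewalTail P G) := fun x y hxy =>
  measureReal_mono fun ω (hω : y < _) => show x < _ from hxy.trans_lt hω

omit [IsProbabilityMeasure P] in
theorem integral_indicator_gap (hG : IsRecurrentGapSequence P G) (s : Set ℕ) :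
    ∫ ω, s.indicator (fun _ => (1 : ℝ)) (G 0 ω) ∂P = P.real {ω | G 0 ω ∈ s} := by
  have : (fun ω => s.indicator (fun _ => (1 : ℝ)) (G 0 ω)) =
      Set.indicator {ω | G 0 ω ∈ s} fun _ => 1 := by
    funext ω; simp [Set.indicator]
  rw [this, integral_indicator_const _ (hG.measurableSet_gap s), smul_eq_mul, mul_one]

theorem integral_indicator_le (hG : IsRecurrentGapSequence P G) (y : ℝ) :
    ∫ ω, {j : ℕ | (j : ℝ) ≤ y}.indicator (fun _ => (1 : ℝ)) (G 0 ω) ∂P =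
      1 - renewalTail P G y := by
  rw [hG.integral_indicator_gap, tail_eq]
  have := probReal_add_probReal_compl (μ := P) (hG.measurableSet_gap {j : ℕ | (j : ℝ) ≤ y})
  have e : {ω | G 0 ω ∈ {j : ℕ | (j : ℝ) ≤ y}}ᶜ = {ω | y < (G 0 ω : ℝ)} := by
    ext ω; simp
  rw [e] at this
  linarith

theorem tendsto_tail (hG : IsRecurrentGapSequence P G) :
    Tendsto (renewalTail P G) atTop (𝓝 0) := by
  have h : Tendsto (fun y : ℝ =>
      ∫ ω, {j : ℕ | (j : ℝ) ≤ y}.indicator (fun _ => (1 : ℝ)) (G 0 ω) ∂P) atTop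
      (𝓝 (∫ _, (1 : ℝ) ∂P)) := by
    refine tendsto_integral_filter_of_dominated_convergence (fun _ => (1 : ℝ))
      (Eventually.of_forall fun y => (hG.measurable_comp 0 _).aestronglyMeasurable)
      (Eventually.of_forall fun y => Eventually.of_forall fun ω => ?_) (integrable_const _)
      (Eventually.of_forall fun ω => ?_)
    · exact (norm_indicator_le_norm_self _ _).trans (by simp)
    · refine tendsto_const_nhds.congr' ?_
      filter_upwards [eventually_ge_atTop (G 0 ω : ℝ)] with y hy
      simp [hy]
  simp_rw [hG.integral_indicator_le] at h
  simpa using h.const_sub 1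

theorem tail_sub_tail (hG : IsRecurrentGapSequence P G) {φ : ℝ → ℝ}
    (hlaw : ∀ n : ℕ, 1 ≤ n → P.real {ω | renewalTime G 1 ω = n} = φ n / n)
    (x y : ℝ) (hx : 0 ≤ x) (hxy : x ≤ y) :
    renewalTail P G x - renewalTail P G y = ∑ j ∈ Finset.Ioc ⌊x⌋₊ ⌊y⌋₊, φ j / j := by
  have h1 : {ω | x < (G 0 ω : ℝ)} \ {ω | y < (G 0 ω : ℝ)} =
      ⋃ j ∈ Finset.Ioc ⌊x⌋₊ ⌊y⌋₊, {ω | G 0 ω = j} := by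
    ext ω
    simp [Nat.floor_lt hx, Nat.le_floor_iff (hx.trans hxy)]
  have hsub : {ω | y < (G 0 ω : ℝ)} ⊆ {ω | x < (G 0 ω : ℝ)} :=
    fun ω (hω : y < _) => show x < _ from hxy.trans_lt hω
  have hmeas : MeasurableSet {ω | y < (G 0 ω : ℝ)} :=
    hG.measurableSet_gap {j : ℕ | y < (j : ℝ)}
  rw [tail_eq, tail_eq, ← measureReal_sdiff hsub hmeas, h1, measureReal_biUnion_finset]
  · refine Finset.sum_congr rfl fun j hj => ?_
    rw [← hlaw j (by rw [Finset.mem_Ioc] at hj; omega), renewalTime_one]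
  · intro i _ j _ hij
    refine Set.disjoint_left.2 fun ω (h1 : _ = i) (h2 : _ = j) => hij (h1.symm.trans h2)
  · exact fun j _ => hG.measurableSet_gap {j}

/-- The truncated mean of a gap is the partial sum of `φ`. -/
theorem integral_truncated (hG : IsRecurrentGapSequence P G) {φ : ℝ → ℝ}
    (hlaw : ∀ n : ℕ, 1 ≤ n → P.real {ω | renewalTime G 1 ω = n} = φ n / n)
    {y : ℝ} (hy : 0 ≤ y) :
    ∫ ω, (G 0 ω : ℝ) * {j : ℕ | (j : ℝ) ≤ y}.indicator (fun _ => (1 : ℝ)) (G 0 ω) ∂P =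
      partialSum φ y := by
  have h1 : ∀ ω, (G 0 ω : ℝ) * {j : ℕ | (j : ℝ) ≤ y}.indicator (fun _ => (1 : ℝ)) (G 0 ω) =
      ∑ j ∈ Finset.Ioc 0 ⌊y⌋₊, ({j} : Set ℕ).indicator (fun _ => (1 : ℝ)) (G 0 ω) * j := by
    intro ω
    simp only [Set.indicator_apply, Set.mem_ofPred_eq, Set.mem_singleton_iff, ite_mul, one_mul,
      zero_mul, Finset.sum_ite_eq, Finset.mem_Ioc, Nat.le_floor_iff hy, mul_ite, mul_one, mul_zero]
    rcases Nat.eq_zero_or_pos (G 0 ω) with h | h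
    · simp [h]
    · simp [h]
  simp_rw [h1]
  rw [integral_finsetSum]
  · refine Finset.sum_congr rfl fun j hj => ?_
    have hj1 : 1 ≤ j := (Finset.mem_Ioc.1 hj).1
    have hj0 : (j : ℝ) ≠ 0 := by positivity
    rw [integral_mul_const, hG.integral_indicator_gap]
    have := hlaw j hj1
    rw [renewalTime_one] at this
    simp only [Set.mem_singleton_iff]
    rw [this, div_mul_cancel₀ _ hj0]
  · intro j _
    refine Integrable.mul_const ?_ _
    refine Integrable.of_bound (hG.measurable_comp 0 _).aestronglyMeasurable 1
      (Eventually.of_forall fun ω => ?_)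
    exact (norm_indicator_le_norm_self _ _).trans (by simp)

omit [IsProbabilityMeasure P] in
theorem integral_indicator_renewalTime (hG : IsRecurrentGapSequence P G) (k : ℕ) (t : ℝ) :
    ∫ ω, {ω | (renewalTime G k ω : ℝ) ≤ t}.indicator (fun _ => (1 : ℝ)) ω ∂P =
      P.real {ω | (renewalTime G k ω : ℝ) ≤ t} := by
  have hm : MeasurableSet {ω | (renewalTime G k ω : ℝ) ≤ t} :=
    hG.measurableSet_renewalTime k {j : ℕ | (j : ℝ) ≤ t}
  rw [integral_indicator_const _ hm, smul_eq_mul, mul_one]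

theorem integrable_indicator_renewalTime (hG : IsRecurrentGapSequence P G) (k : ℕ) (t : ℝ) :
    Integrable ({ω | (renewalTime G k ω : ℝ) ≤ t}.indicator (fun _ => (1 : ℝ))) P :=
  (integrable_const _).indicator (hG.measurableSet_renewalTime k {j : ℕ | (j : ℝ) ≤ t})

theorem integrable_prod (hG : IsRecurrentGapSequence P G) (k : ℕ) {f : ℕ → ℝ}
    (h0 : ∀ n, 0 ≤ f n) (h1 : ∀ n, f n ≤ 1) :
    Integrable (fun ω => ∏ i ∈ Finset.range k, f (G i ω)) P := by
  refine Integrable.of_bound (hG.measurable_prod k f).aestronglyMeasurable 1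
    (Eventually.of_forall fun ω => ?_)
  rw [Real.norm_eq_abs, abs_of_nonneg (Finset.prod_nonneg fun i _ => h0 _)]
  exact Finset.prod_le_one (fun i _ => h0 _) fun i _ => h1 _

theorem prob_le_one_sub_tail_pow (hG : IsRecurrentGapSequence P G) (k : ℕ) (t : ℝ) :
    P.real {ω | (renewalTime G k ω : ℝ) ≤ t} ≤ (1 - renewalTail P G t) ^ k := by
  set c : ℕ → ℝ := {j : ℕ | (j : ℝ) ≤ t}.indicator fun _ => 1 with hc
  have c0 : ∀ n, 0 ≤ c n := fun n => Set.indicator_nonneg (fun _ _ => zero_le_one) n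
  have c1 : ∀ n, c n ≤ 1 := fun n => Set.indicator_le_self' (fun _ _ => zero_le_one) n
  have h := hG.integral_prod k fun _ => c
  rw [Finset.prod_const, Finset.card_range, hG.integral_indicator_le] at h
  rw [← h, ← hG.integral_indicator_renewalTime]
  refine integral_mono (hG.integrable_indicator_renewalTime k t) (hG.integrable_prod k c0 c1)
    fun ω => ?_
  by_cases hω : (renewalTime G k ω : ℝ) ≤ t
  · have : ∀ i ∈ Finset.range k, c (G i ω) = 1 := fun i hi => by
      have : (G i ω : ℝ) ≤ t := le_trans (by exact_mod_cast gap_le_renewalTime G hi ω) hω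
      simp [hc, this]
    simp [hω, Finset.prod_congr rfl this]
  · simpa [hω] using Finset.prod_nonneg fun i _ => c0 _

/-- The exponential Markov inequality for `{τ_k ≤ t}`. The Laplace transform of a gap at `l` is at
most that of a variable equal to `0` when the gap is at most `y`, and to `y` otherwise. -/
theorem prob_le_exp (hG : IsRecurrentGapSequence P G) (k : ℕ) (t y : ℝ) {l : ℝ} (hl : 0 ≤ l) :
    P.real {ω | (renewalTime G k ω : ℝ) ≤ t} ≤
      Real.exp (l * t - k * ((1 - Real.exp (-(l * y))) * renewalTail P G y)) := by
  set f : ℕ → ℝ := fun n => Real.exp (-(l * n)) with hf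
  have f0 : ∀ n, 0 ≤ f n := fun n => (Real.exp_pos _).le
  have f1 : ∀ n, f n ≤ 1 := fun n => Real.exp_le_one_iff.2
    (neg_nonpos.2 (mul_nonneg hl (Nat.cast_nonneg n)))
  have h := hG.integral_prod k fun _ => f
  rw [Finset.prod_const, Finset.card_range] at h
  have hone : ∫ ω, f (G 0 ω) ∂P ≤
      Real.exp (-((1 - Real.exp (-(l * y))) * renewalTail P G y)) := by
    have hind := hG.integral_indicator_le y
    have hint : Integrable (fun ω => {j : ℕ | (j : ℝ) ≤ y}.indicator (fun _ => (1 : ℝ)) (G 0 ω))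
        P := Integrable.of_bound (hG.measurable_comp 0 _).aestronglyMeasurable 1
      (Eventually.of_forall fun ω => (norm_indicator_le_norm_self _ _).trans (by simp))
    have hle : ∫ ω, f (G 0 ω) ∂P ≤ ∫ ω, (Real.exp (-(l * y)) + (1 - Real.exp (-(l * y))) *
        {j : ℕ | (j : ℝ) ≤ y}.indicator (fun _ => (1 : ℝ)) (G 0 ω)) ∂P := by
      refine integral_mono (by simpa using hG.integrable_prod 1 f0 f1)
        ((integrable_const _).add (hint.const_mul _)) fun ω => ?_
      by_cases hω : (G 0 ω : ℝ) ≤ y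
      · simpa [hω] using f1 (G 0 ω)
      · simp only [Set.indicator_apply, Set.mem_ofPred_eq, hω, if_false, mul_zero, add_zero]
        refine Real.exp_le_exp.2 (neg_le_neg (mul_le_mul_of_nonneg_left (not_le.1 hω).le hl))
    rw [integral_add (integrable_const _) (hint.const_mul _), integral_const_mul, hind] at hle
    simp only [integral_const, probReal_univ, smul_eq_mul, one_mul] at hle
    refine hle.trans (le_trans (le_of_eq ?_) (Real.one_sub_le_exp_neg _))
    ring
  have hexp : Real.exp (l * t - k * ((1 - Real.exp (-(l * y))) * renewalTail P G y)) =
      Real.exp (l * t) * Real.exp (-((1 - Real.exp (-(l * y))) * renewalTail P G y)) ^ k := by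
    rw [← Real.exp_nat_mul, ← Real.exp_add]
    congr 1
    ring
  rw [hexp, ← hG.integral_indicator_renewalTime]
  calc _ ≤ ∫ ω, Real.exp (l * t) * ∏ i ∈ Finset.range k, f (G i ω) ∂P := by
        refine integral_mono (hG.integrable_indicator_renewalTime k t)
          ((hG.integrable_prod k f0 f1).const_mul _) fun ω => ?_
        by_cases hω : (renewalTime G k ω : ℝ) ≤ t
        · simp only [Set.indicator_apply, Set.mem_ofPred_eq, hω, if_true, hf]
          rw [← Real.exp_sum, ← Real.exp_add, Finset.sum_neg_distrib, ← Finset.mul_sum,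
            Real.one_le_exp_iff]
          have := mul_le_mul_of_nonneg_left hω hl
          rw [renewalTime, Nat.cast_sum] at this
          linarith
        · simp only [Set.indicator_apply, Set.mem_ofPred_eq, hω, if_false]
          exact mul_nonneg (Real.exp_pos _).le (Finset.prod_nonneg fun i _ => f0 _)
    _ ≤ _ := by
        rw [integral_const_mul, h]
        refine mul_le_mul_of_nonneg_left (pow_le_pow_left₀ ?_ hone k) (Real.exp_pos _).le
        exact integral_nonneg fun ω => f0 _

/-- The lower bound obtained by forbidding gaps larger than `y` and applying Markov's inequality
to the sum of the gaps on that event. -/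
theorem le_prob (hG : IsRecurrentGapSequence P G) {φ : ℝ → ℝ}
    (hlaw : ∀ n : ℕ, 1 ≤ n → P.real {ω | renewalTime G 1 ω = n} = φ n / n)
    (k : ℕ) {t y : ℝ} (ht : 0 < t) (hy : 0 ≤ y) (hq : 0 < 1 - renewalTail P G y) :
    (1 - renewalTail P G y) ^ k *
        (1 - k * partialSum φ y / (t * (1 - renewalTail P G y))) ≤
      P.real {ω | (renewalTime G k ω : ℝ) ≤ t} := by
  set q := 1 - renewalTail P G y with hqdef
  set c : ℕ → ℝ := {j : ℕ | (j : ℝ) ≤ y}.indicator fun _ => 1 with hc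
  have c0 : ∀ n, 0 ≤ c n := fun n => Set.indicator_nonneg (fun _ _ => zero_le_one) n
  have c1 : ∀ n, c n ≤ 1 := fun n => Set.indicator_le_self' (fun _ _ => zero_le_one) n
  have cy : ∀ n : ℕ, (n : ℝ) * c n ≤ y := fun n => by
    by_cases h : (n : ℝ) ≤ y <;> simp [hc, h, hy]
  have hqk := hG.integral_prod k fun _ => c
  rw [Finset.prod_const, Finset.card_range, hG.integral_indicator_le] at hqk
  have hterm : ∀ i ∈ Finset.range k,
      ∫ ω, (G i ω : ℝ) * ∏ j ∈ Finset.range k, c (G j ω) ∂P = q ^ k * (partialSum φ y / q) := by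
    intro i hi
    have e : ∀ ω, (G i ω : ℝ) * ∏ j ∈ Finset.range k, c (G j ω) =
        ∏ j ∈ Finset.range k, (fun n : ℕ => (if j = i then (n : ℝ) else 1) * c n) (G j ω) := by
      intro ω
      simp only [Finset.prod_mul_distrib, Finset.prod_ite_eq', hi, if_true]
    simp_rw [e]
    rw [hG.integral_prod k fun j n => (if j = i then (n : ℝ) else 1) * c n,
      ← Finset.mul_prod_erase _ _ hi]
    have e2 : ∀ j ∈ (Finset.range k).erase i,
        ∫ ω, (if j = i then (G 0 ω : ℝ) else 1) * c (G 0 ω) ∂P = q := fun j hj => by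
      simp only [Finset.ne_of_mem_erase hj, if_false, one_mul]
      exact hG.integral_indicator_le y
    rw [Finset.prod_congr rfl e2, Finset.prod_const, Finset.card_erase_of_mem hi,
      Finset.card_range]
    simp only [if_true]
    rw [hG.integral_truncated hlaw hy]
    have hk : k ≠ 0 := by rintro rfl; simp at hi
    rw [← mul_pow_sub_one hk q]
    field_simp
  have hint : ∀ i ∈ Finset.range k,
      Integrable (fun ω => (G i ω : ℝ) * ∏ j ∈ Finset.range k, c (G j ω)) P := fun i hi => by
    refine Integrable.of_bound ((hG.measurable_comp i (fun n => n)).mul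
      (hG.measurable_prod k c)).aestronglyMeasurable y (Eventually.of_forall fun ω => ?_)
    rw [Real.norm_eq_abs, abs_of_nonneg (mul_nonneg (Nat.cast_nonneg _)
      (Finset.prod_nonneg fun i _ => c0 _)), ← Finset.mul_prod_erase _ _ hi, ← mul_assoc]
    exact (mul_le_of_le_one_right (mul_nonneg (Nat.cast_nonneg _) (c0 _))
      (Finset.prod_le_one (fun i _ => c0 _) fun i _ => c1 _)).trans (cy _)
  -- The left-hand side is the expectation of `(1 - τ_k / t) ∏ 1{G_j ≤ y} ≤ 1{τ_k ≤ t}`.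
  have hlhs : q ^ k * (1 - k * partialSum φ y / (t * q)) =
      ∫ ω, ((∏ j ∈ Finset.range k, c (G j ω)) -
        1 / t * ∑ i ∈ Finset.range k, (G i ω : ℝ) * ∏ j ∈ Finset.range k, c (G j ω)) ∂P := by
    rw [integral_sub (hG.integrable_prod k c0 c1) ((integrable_finsetSum _ hint).const_mul _),
      integral_const_mul, integral_finsetSum _ hint, Finset.sum_congr rfl hterm, hqk,
      Finset.sum_const, Finset.card_range, nsmul_eq_mul,
      ← hqdef]
    field_simp
  rw [hlhs, ← hG.integral_indicator_renewalTime]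
  refine integral_mono ((hG.integrable_prod k c0 c1).sub
    ((integrable_finsetSum _ hint).const_mul _)) (hG.integrable_indicator_renewalTime k t)
    fun ω => ?_
  have hs : ∑ i ∈ Finset.range k, (G i ω : ℝ) * ∏ j ∈ Finset.range k, c (G j ω) =
      renewalTime G k ω * ∏ j ∈ Finset.range k, c (G j ω) := by
    rw [← Finset.sum_mul, renewalTime, Nat.cast_sum]
  simp only [hs]
  have p0 : 0 ≤ ∏ j ∈ Finset.range k, c (G j ω) := Finset.prod_nonneg fun i _ => c0 _
  have p1 : ∏ j ∈ Finset.range k, c (G j ω) ≤ 1 :=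
    Finset.prod_le_one (fun i _ => c0 _) fun i _ => c1 _
  have e : (∏ j ∈ Finset.range k, c (G j ω)) -
      1 / t * (renewalTime G k ω * ∏ j ∈ Finset.range k, c (G j ω)) =
      (1 - renewalTime G k ω / t) * ∏ j ∈ Finset.range k, c (G j ω) := by ring
  rw [e]
  by_cases hω : (renewalTime G k ω : ℝ) ≤ t
  · simp only [Set.indicator_apply, Set.mem_ofPred_eq, hω, if_true]
    refine mul_le_one₀ (sub_le_self _ (by positivity)) p0 p1
  · simp only [Set.indicator_apply, Set.mem_ofPred_eq, hω, if_false]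
    refine mul_nonpos_of_nonpos_of_nonneg ?_ p0
    rw [sub_nonpos, one_le_div ht]
    exact (not_le.1 hω).le

/-- Supermultiplicativity: the sum of the gaps `k, …, k + l - 1` is independent of `τ_k` and
distributed as `τ_l`. -/
theorem prob_mul_le (hG : IsRecurrentGapSequence P G) (k l : ℕ) (s t : ℝ) :
    P.real {ω | (renewalTime G k ω : ℝ) ≤ s} * P.real {ω | (renewalTime G l ω : ℝ) ≤ t} ≤
      P.real {ω | (renewalTime G (k + l) ω : ℝ) ≤ s + t} := by
  set S : Ω → ℕ := fun ω => ∑ i ∈ Finset.range l, G (k + i) ω with hS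
  have hshift : IdentDistrib (fun ω i => G (k + i) ω) (fun ω i => G i ω) P P :=
    IdentDistrib.pi (fun i => (hG.identDistrib (k + i)).trans (hG.identDistrib i).symm)
      (hG.indep.precomp (add_right_injective k)) hG.indep
  have hid : IdentDistrib S (renewalTime G l) P P :=
    hshift.comp (u := fun x : ℕ → ℕ => ∑ i ∈ Finset.range l, x i)
      (Finset.measurable_fun_sum _ fun i _ => measurable_pi_apply i)
  have hSIco : ∀ ω, S ω = ∑ i ∈ Finset.Ico k (k + l), G i ω := fun ω => by
    rw [Finset.sum_Ico_eq_sum_range]; simp [hS]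
  have hdisj : Disjoint (Finset.range k) (Finset.Ico k (k + l)) := by
    rw [Finset.range_eq_Ico]; exact Finset.Ico_disjoint_Ico_consecutive _ _ _
  have hind : IndepFun (renewalTime G k) S P := by
    have h := (hG.indep.indepFun_finset _ _ hdisj hG.measurable).comp
      (φ := fun x : Finset.range k → ℕ => ∑ i, x i)
      (ψ := fun x : Finset.Ico k (k + l) → ℕ => ∑ i, x i)
      (Finset.measurable_fun_sum _ fun i _ => measurable_pi_apply i)
      (Finset.measurable_fun_sum _ fun i _ => measurable_pi_apply i)
    have e1 : (fun x : Finset.range k → ℕ => ∑ i, x i) ∘ (fun ω (i : Finset.range k) => G i ω) =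
        renewalTime G k := by
      funext ω
      exact Finset.sum_coe_sort (Finset.range k) fun i => G i ω
    have e2 : (fun x : Finset.Ico k (k + l) → ℕ => ∑ i, x i) ∘
        (fun ω (i : Finset.Ico k (k + l)) => G i ω) = S := by
      funext ω
      rw [hSIco]
      exact Finset.sum_coe_sort (Finset.Ico k (k + l)) fun i => G i ω
    rwa [e1, e2] at h
  have h2 : P.real {ω | (renewalTime G l ω : ℝ) ≤ t} = P.real {ω | (S ω : ℝ) ≤ t} := by
    have := hid.measure_mem_eq (s := {j : ℕ | (j : ℝ) ≤ t}) MeasurableSet.of_discrete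
    rw [measureReal_def, measureReal_def]
    exact congrArg _ this.symm
  have h3 := hind.measure_inter_preimage_eq_mul {j : ℕ | (j : ℝ) ≤ s} {j : ℕ | (j : ℝ) ≤ t}
    MeasurableSet.of_discrete MeasurableSet.of_discrete
  have h4 := congrArg ENNReal.toReal h3
  rw [ENNReal.toReal_mul] at h4
  rw [h2]
  refine (h4.symm.le).trans (measureReal_mono fun ω hω => ?_)
  obtain ⟨a, b⟩ := hω
  simp only [Set.mem_preimage, Set.mem_ofPred_eq] at a b ⊢
  have : renewalTime G (k + l) ω = renewalTime G k ω + S ω := by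
    rw [renewalTime, renewalTime, hSIco, Finset.sum_range_add_sum_Ico _ (Nat.le_add_right k l)]
  rw [this]
  push_cast
  linarith

end IsRecurrentGapSequence

/-! ### The three asymptotic regimes -/

theorem exp_neg_div_one_sub_le {u : ℝ} (hu : u < 1) : Real.exp (-(u / (1 - u))) ≤ 1 - u := by
  have h : 0 < 1 - u := by linarith
  rw [← Real.le_log_iff_exp_le h]
  refine le_trans (le_of_eq ?_) (Real.one_sub_inv_le_log_of_pos h)
  field_simp
  ring

namespace IsRecurrentGapSequence

variable {Ω : Type*} [MeasurableSpace Ω] {P : Measure Ω} [IsProbabilityMeasure P]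
  {G : ℕ → Ω → ℕ} {φ : ℝ → ℝ}

omit [IsProbabilityMeasure P] in
theorem law_nonneg (hlaw : ∀ n : ℕ, 1 ≤ n → P.real {ω | renewalTime G 1 ω = n} = φ n / n)
    (j : ℕ) (hj : 1 ≤ j) : 0 ≤ φ j := by
  have h : 0 ≤ φ j / j := hlaw j hj ▸ measureReal_nonneg
  have hj0 : (0 : ℝ) < j := by exact_mod_cast hj
  have := mul_nonneg h hj0.le
  rwa [div_mul_cancel₀ _ hj0.ne'] at this

/-- The lower bound in the regime `k φ(x) ≤ M`, with gaps truncated at `x / 2 ^ i`. The first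
factor is the loss in Markov's inequality, the second one the cost of replacing `r(x / 2 ^ i)` by
`r(x)`. -/
theorem eventually_le_prob_of_mul_le (hG : IsRecurrentGapSequence P G) (hφ : SlowlyVarying φ)
    (hlaw : ∀ n : ℕ, 1 ≤ n → P.real {ω | renewalTime G 1 ω = n} = φ n / n)
    {C : ℝ} (hC : 0 < C) (hCs : ∀ᶠ x in atTop, partialSum φ x ≤ C * (x * φ x))
    {M : ℝ} (i : ℕ) (hi : 8 * C * M ≤ 2 ^ i) :
    ∀ᶠ x in atTop, ∀ k : ℕ, k * φ x ≤ M →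
      (1 - 4 * C * M / 2 ^ i) * Real.exp (-(32 * i * M)) * (1 - renewalTail P G x) ^ k ≤
        P.real {ω | (renewalTime G k ω : ℝ) ≤ x} := by
  have ht : Tendsto (fun x : ℝ => x / 2 ^ i) atTop atTop :=
    tendsto_id.atTop_div_const (by positivity)
  have hlim := (hφ.tendsto_div (c := (2 ^ i)⁻¹) (by positivity)).eventually_le_const
    (by norm_num : (1 : ℝ) < 2)
  have hsmall : ∀ᶠ x in atTop, 16 * i * (8 * renewalTail P G x) < 1 / 2 := by
    have := (hG.tendsto_tail.const_mul 8).const_mul (16 * (i : ℝ))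
    rw [mul_zero, mul_zero] at this
    exact this.eventually_lt_const (by norm_num)
  have hhalf := (hG.tendsto_tail.comp ht).eventually_le_const (by norm_num : (0 : ℝ) < 1 / 2)
  filter_upwards [ht.eventually hCs, hlim, hφ.eventually_pos,
    eventually_tail_div_two_pow_le hφ (hG.tail_sub_tail hlaw) i, hsmall, hhalf,
    eventually_tail_sub hφ (hG.tail_sub_tail hlaw), eventually_gt_atTop 0]
    with x h1 h2 h3 h4 h5 h6 h7 hx k hk
  simp only [Function.comp] at h6
  rw [inv_mul_eq_div, div_le_iff₀ h3] at h2
  set r := renewalTail P G with hr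
  set y := x / 2 ^ i with hy
  have hp : (0 : ℝ) < 2 ^ i := by positivity
  have hy0 : 0 < y := by positivity
  have hyx : y ≤ x := div_le_self hx.le (one_le_pow₀ one_le_two)
  have hq : 1 / 2 ≤ 1 - r y := by linarith
  have hrx : r x ≤ r y := tail_anti hyx
  have hφr : φ x ≤ 8 * r x := by linarith [h7.1, tail_nonneg (P := P) (G := G) (2 * x)]
  have hmain := hG.le_prob hlaw k hx hy0.le (show 0 < 1 - r y by linarith)
  refine le_trans ?_ hmain
  have hA : partialSum φ y ≤ x * (2 * C * φ x / 2 ^ i) := by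
    calc partialSum φ y ≤ C * (y * φ y) := h1
      _ ≤ C * (y * (2 * φ x)) := by gcongr
      _ = x * (2 * C * φ x / 2 ^ i) := by rw [hy]; ring
  have hfac : 1 - 4 * C * M / 2 ^ i ≤ 1 - k * partialSum φ y / (x * (1 - r y)) := by
    have hxq : x * (1 / 2) ≤ x * (1 - r y) := mul_le_mul_of_nonneg_left hq hx.le
    have hA0 := partialSum_nonneg (law_nonneg hlaw) y
    have : k * partialSum φ y / (x * (1 - r y)) ≤ 4 * C * M / 2 ^ i := by
      calc k * partialSum φ y / (x * (1 - r y))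
          ≤ k * (x * (2 * C * φ x / 2 ^ i)) / (x * (1 / 2)) := by gcongr
        _ = 4 * C * (k * φ x) / 2 ^ i := by field_simp; ring
        _ ≤ 4 * C * M / 2 ^ i := by gcongr
    linarith
  have hfac0 : 0 ≤ 1 - 4 * C * M / 2 ^ i := by
    have : 4 * C * M / 2 ^ i ≤ 1 / 2 := by
      rw [div_le_iff₀ hp]; linarith
    linarith
  have hpow : Real.exp (-(32 * i * M)) * (1 - r x) ^ k ≤ (1 - r y) ^ k := by
    set u := 16 * i * φ x with hu
    have hu0 : 0 ≤ u := by positivity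
    have hu1 : u ≤ 1 / 2 := by
      have : u ≤ 16 * i * (8 * r x) := by rw [hu]; gcongr
      linarith
    have hexp : Real.exp (-(2 * u)) ≤ 1 - u := by
      refine le_trans (Real.exp_le_exp.2 (neg_le_neg ?_)) (exp_neg_div_one_sub_le (by linarith))
      rw [div_le_iff₀ (by linarith)]
      nlinarith
    have hstep : Real.exp (-(2 * u)) * (1 - r x) ≤ 1 - r y := by
      have hrx2 : 1 / 2 ≤ 1 - r x := by linarith
      have h8 : (1 - u) * (1 - r x) ≤ 1 - r y := by
        have := mul_le_mul_of_nonneg_left hrx2 hu0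
        have e : 8 * i * φ x = u * (1 / 2) := by rw [hu]; ring
        linarith
      exact (mul_le_mul_of_nonneg_right hexp (by linarith)).trans h8
    have hexpk : Real.exp (-(32 * i * M)) ≤ Real.exp (-(2 * u)) ^ k := by
      rw [← Real.exp_nat_mul]
      refine Real.exp_le_exp.2 ?_
      have : 32 * i * (k * φ x) ≤ 32 * i * M := by gcongr
      have e : (k : ℝ) * -(2 * u) = -(32 * i * (k * φ x)) := by rw [hu]; ring
      linarith
    have h1r : 0 ≤ 1 - r x := by linarith
    calc _ ≤ Real.exp (-(2 * u)) ^ k * (1 - r x) ^ k := by gcongr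
      _ = (Real.exp (-(2 * u)) * (1 - r x)) ^ k := (mul_pow _ _ _).symm
      _ ≤ _ := pow_le_pow_left₀ (mul_nonneg (Real.exp_pos _).le h1r) hstep k
  calc _ = (Real.exp (-(32 * i * M)) * (1 - r x) ^ k) * (1 - 4 * C * M / 2 ^ i) := by ring
    _ ≤ _ := mul_le_mul hpow hfac hfac0 (pow_nonneg (by linarith) k)

theorem exists_const_mul_le_prob (hG : IsRecurrentGapSequence P G) (hφ : SlowlyVarying φ)
    (hlaw : ∀ n : ℕ, 1 ≤ n → P.real {ω | renewalTime G 1 ω = n} = φ n / n) :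
    ∃ a : ℝ → ℝ, (∀ M : ℝ, 0 < M → 0 < a M) ∧ Tendsto a (𝓝[>] 0) (𝓝 1) ∧
      ∀ M : ℝ, 0 < M → ∃ N : ℕ, ∀ n k : ℕ, N ≤ n → k ≤ n → (k : ℝ) * φ n ≤ M →
        a M * (1 - renewalTail P G n) ^ k ≤ P.real {ω | renewalTime G k ω ≤ n} ∧
        P.real {ω | renewalTime G k ω ≤ n} ≤ (1 - renewalTail P G n) ^ k := by
  obtain ⟨C, hC, hCs⟩ := exists_eventually_partialSum_le hφ (law_nonneg hlaw)
  -- The least `i` that makes the Markov term at most `1 / 2`; it vanishes for small `M`.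
  set i : ℝ → ℕ := fun M => Nat.clog 2 ⌈8 * C * M⌉₊ with hi
  have hiM : ∀ M, 8 * C * M ≤ 2 ^ i M := fun M =>
    (Nat.le_ceil _).trans (by exact_mod_cast Nat.le_pow_clog one_lt_two _)
  refine ⟨fun M => (1 - 4 * C * M / 2 ^ i M) * Real.exp (-(32 * i M * M)), fun M _ => ?_, ?_,
    fun M _ => ?_⟩
  · refine mul_pos ?_ (Real.exp_pos _)
    have : 4 * C * M / 2 ^ i M ≤ 1 / 2 := by
      rw [div_le_iff₀ (by positivity)]; linarith [hiM M]
    linarith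
  · have h : Tendsto (fun M : ℝ => 1 - 4 * C * M) (𝓝[>] 0) (𝓝 1) := by
      have : Continuous fun M : ℝ => 1 - 4 * C * M := by fun_prop
      simpa using (this.tendsto 0).mono_left nhdsWithin_le_nhds
    refine h.congr' ?_
    have hsm : ∀ᶠ M : ℝ in 𝓝[>] 0, 8 * C * M < 1 := by
      have : Continuous fun M : ℝ => 8 * C * M := by fun_prop
      refine nhdsWithin_le_nhds ((this.tendsto 0).eventually_lt_const ?_)
      simp
    filter_upwards [hsm] with M hM
    have : i M = 0 := Nat.clog_of_right_le_one (Nat.ceil_le.2 (by simpa using hM.le)) 2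
    simp [this]
  · obtain ⟨N, hN⟩ := eventually_atTop.1 (tendsto_natCast_atTop_atTop.eventually
      (hG.eventually_le_prob_of_mul_le hφ hlaw hC hCs (i M) (hiM M)))
    refine ⟨N, fun n k hn _ hk => ?_⟩
    have h1 := hN n hn k hk
    have h2 := hG.prob_le_one_sub_tail_pow k n
    simp only [Nat.cast_le] at h1 h2
    exact ⟨h1, h2⟩

/-- The common source of the last two regimes: `P(τ_k ≤ b k)` is `exp(-(1 ± δ) k r(b φ*(b)))` up
to a factor `1 / 2`, uniformly in `k`, for large `b`. -/
theorem eventually_prob_bounds (hG : IsRecurrentGapSequence P G) (hφ : SlowlyVarying φ)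
    (hlaw : ∀ n : ℕ, 1 ≤ n → P.real {ω | renewalTime G 1 ω = n} = φ n / n)
    {φs : ℝ → ℝ} (hφs : IsDeBruijnConjugate φs φ) {δ : ℝ} (hδ : 0 < δ) (hδ1 : δ ≤ 1) :
    ∀ᶠ b in atTop, ∀ k : ℕ,
      1 / 2 * Real.exp (-((1 + δ) * (k * renewalTail P G (b * φs b)))) ≤
        P.real {ω | (renewalTime G k ω : ℝ) ≤ b * k} ∧
      P.real {ω | (renewalTime G k ω : ℝ) ≤ b * k} ≤
        Real.exp (-((1 - δ) * (k * renewalTail P G (b * φs b)))) := by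
  set r := renewalTail P G with hr
  have hr0 : ∀ x, 0 ≤ r x := tail_nonneg
  have hrs := hG.tail_sub_tail hlaw
  obtain ⟨C, hC, hCs⟩ := exists_eventually_partialSum_le hφ (law_nonneg hlaw)
  have hm : Tendsto (fun b => b * φs b) atTop atTop := hφs.1.tendsto_mul_atTop
  have hratio := (isEquivalent_iff_tendsto_one
    ((eventually_ne_atTop 0).mono fun x hx => hx)).1 hφs.2.1
  -- The cutoff is `2 ^ i m` in the upper bound and `m / 2 ^ l` in the lower bound.
  obtain ⟨i, hi⟩ : ∃ i : ℕ, Real.exp (-(2 ^ i)) ≤ δ / 4 := by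
    have : Tendsto (fun i : ℕ => Real.exp (-(2 ^ i : ℝ))) atTop (𝓝 0) :=
      Real.tendsto_exp_neg_atTop_nhds_zero.comp (tendsto_pow_atTop_atTop_of_one_lt one_lt_two)
    exact (this.eventually_le_const (by linarith)).exists
  obtain ⟨l, hl⟩ := pow_unbounded_of_one_lt (16 * C) (one_lt_two (α := ℝ))
  have ht : Tendsto (fun x : ℝ => x / 2 ^ l) atTop atTop :=
    tendsto_id.atTop_div_const (by positivity)
  have hφl := (hφ.tendsto_div (c := (2 ^ l)⁻¹) (by positivity)).eventually_le_const
    (by norm_num : (1 : ℝ) < 2)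
  filter_upwards [hratio.eventually_const_le (by norm_num : (1 / 2 : ℝ) < 1),
    hratio.eventually_le_const (by norm_num : (1 : ℝ) < 2), eventually_gt_atTop 0,
    hm.eventually (eventually_gt_atTop 0), hm.eventually hφ.eventually_pos,
    hm.eventually (eventually_tail_pos hφ hr0 hrs),
    hm.eventually ((tendsto_div_tail hφ hr0 hrs).eventually_le_const
      (by linarith : (0 : ℝ) < δ / 8)),
    hm.eventually ((tendsto_tail_two_pow_mul hφ hr0 hrs i).eventually_const_le
      (by linarith : 1 - δ / 4 < 1)),
    hm.eventually ((tendsto_tail_div_two_pow hφ hr0 hrs l).eventually_le_const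
      (by linarith : 1 < 1 + δ / 4)),
    hm.eventually ((hG.tendsto_tail.comp ht).eventually_le_const
      (by linarith : (0 : ℝ) < δ / 4)),
    hm.eventually (ht.eventually hCs), hm.eventually hφl]
    with b h1 h2 hb hm0 hφm hrm h3 h4 h5 h6 h7 h8 k
  simp only [Pi.div_apply, Function.comp] at h1 h2 h6
  set m := b * φs b with hmdef
  rw [div_le_iff₀ hb] at h2
  rw [le_div_iff₀ hb] at h1
  rw [div_le_iff₀ hrm] at h3 h5
  rw [le_div_iff₀ hrm] at h4
  rw [inv_mul_eq_div, div_le_iff₀ hφm] at h8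
  have hk0 : (0 : ℝ) ≤ k := Nat.cast_nonneg k
  constructor
  · -- `le_prob` divides by `b k`, hence the separate case `k = 0`.
    rcases Nat.eq_zero_or_pos k with rfl | hk
    · norm_num [renewalTime]
    have hkpos : (0 : ℝ) < k := by exact_mod_cast hk
    set y := m / 2 ^ l with hy
    have hy0 : 0 < y := by positivity
    have hq : 1 / 2 ≤ 1 - r y := by linarith
    have hmain := hG.le_prob hlaw k (mul_pos hb hkpos) hy0.le (show 0 < 1 - r y by linarith)
    refine le_trans ?_ hmain
    have hfac : 1 / 2 ≤ 1 - k * partialSum φ y / (b * k * (1 - r y)) := by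
      have hA : partialSum φ y ≤ b / 4 := by
        calc partialSum φ y ≤ C * (y * φ y) := h7
          _ ≤ C * (y * (2 * φ m)) := by gcongr
          _ = 2 * C / 2 ^ l * (m * φ m) := by rw [hy]; ring
          _ ≤ 2 * C / 2 ^ l * (2 * b) := by gcongr
          _ = (4 * C) / 2 ^ l * b := by ring
          _ ≤ 1 / 4 * b := by
            refine mul_le_mul_of_nonneg_right ?_ hb.le
            rw [div_le_iff₀ (by positivity)]
            linarith
          _ = b / 4 := by ring
      have : k * partialSum φ y / (b * k * (1 - r y)) ≤ 1 / 2 := by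
        rw [div_le_iff₀ (by positivity)]
        calc k * partialSum φ y ≤ k * (b / 4) := by gcongr
          _ = 1 / 2 * (b * k * (1 / 2)) := by ring
          _ ≤ 1 / 2 * (b * k * (1 - r y)) := by gcongr
      linarith
    have hpow : Real.exp (-((1 + δ) * (k * r m))) ≤ (1 - r y) ^ k := by
      refine le_trans ?_ (pow_le_pow_left₀ (Real.exp_pos _).le
        (exp_neg_div_one_sub_le (show r y < 1 by linarith)) k)
      rw [← Real.exp_nat_mul]
      refine Real.exp_le_exp.2 ?_
      have h9 : r y / (1 - r y) ≤ (1 + δ) * r m := by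
        rw [div_le_iff₀ (by linarith)]
        have hb1 : (1 + δ / 4) ≤ (1 + δ) * (1 - r y) := by nlinarith
        calc r y ≤ (1 + δ / 4) * r m := h5
          _ ≤ ((1 + δ) * (1 - r y)) * r m := mul_le_mul_of_nonneg_right hb1 hrm.le
          _ = _ := by ring
      have := mul_le_mul_of_nonneg_left h9 hk0
      linarith
    calc 1 / 2 * Real.exp (-((1 + δ) * (k * r m)))
        = Real.exp (-((1 + δ) * (k * r m))) * (1 / 2) := mul_comm _ _
      _ ≤ _ := mul_le_mul hpow hfac (by norm_num) (pow_nonneg (by linarith) k)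
  · have hmain := hG.prob_le_exp k (b * k) (2 ^ i * m) (l := 1 / m) (by positivity)
    refine hmain.trans (Real.exp_le_exp.2 ?_)
    have e1 : 1 / m * (2 ^ i * m) = 2 ^ i := by field_simp
    rw [e1]
    have h9 : b / m ≤ δ / 4 * r m := by
      rw [div_le_iff₀ hm0]
      have := mul_le_mul_of_nonneg_left h3 hm0.le
      linarith
    have h10 : (1 - δ / 4) * ((1 - δ / 4) * r m) ≤ (1 - Real.exp (-(2 ^ i))) * r (2 ^ i * m) :=
      mul_le_mul (by linarith) h4 (mul_nonneg (by linarith) hrm.le) (by linarith)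
    have h11 : b / m - (1 - Real.exp (-(2 ^ i))) * r (2 ^ i * m) ≤ -((1 - δ) * r m) := by
      nlinarith [mul_pos hδ hrm, mul_pos hδ (mul_pos hδ hrm)]
    have h12 := mul_le_mul_of_nonneg_left h11 hk0
    calc _ = k * (b / m - (1 - Real.exp (-(2 ^ i))) * r (2 ^ i * m)) := by ring
      _ ≤ _ := h12
      _ = _ := by ring

/-- With `m = (n / k) φ*(n / k)`, the exponent `k r(m)` tends to infinity. If `m ≤ n` then
`k r(m) ≥ k r(n) ≥ k φ(n) / 8`. For large indices `m > n` is impossible: monotonicity of the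
partial sums would give `n φ(n) / 16 ≤ A(n) ≤ A(m) ≤ C m φ(m) ≤ 2 C n / k`, and `k φ(n)` would be
bounded. -/
theorem tendsto_mul_tail_conjugate (hG : IsRecurrentGapSequence P G) (hφ : SlowlyVarying φ)
    (hlaw : ∀ n : ℕ, 1 ≤ n → P.real {ω | renewalTime G 1 ω = n} = φ n / n)
    {φs : ℝ → ℝ} (hφs : IsDeBruijnConjugate φs φ) {k n : ℕ → ℕ}
    (hn : Tendsto n atTop atTop)
    (hkφ : Tendsto (fun j => (k j : ℝ) * φ (n j)) atTop atTop)
    (hnk : Tendsto (fun j => (n j : ℝ) / k j) atTop atTop) :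
    Tendsto (fun j => k j * renewalTail P G ((n j : ℝ) / k j * φs ((n j : ℝ) / k j)))
      atTop atTop := by
  set r := renewalTail P G with hr
  obtain ⟨C, hC, hCs⟩ := exists_eventually_partialSum_le hφ (law_nonneg hlaw)
  have hm := hφs.1.tendsto_mul_atTop.comp hnk
  have hnR : Tendsto (fun j => (n j : ℝ)) atTop atTop := tendsto_natCast_atTop_atTop.comp hn
  have hratio := (isEquivalent_iff_tendsto_one
    ((eventually_ne_atTop 0).mono fun x hx => hx)).1 hφs.2.1
  refine tendsto_atTop_mono' atTop ?_ (hkφ.atTop_div_const (show (0 : ℝ) < 8 by norm_num))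
  filter_upwards [hnk.eventually (hratio.eventually_le_const (by norm_num : (1 : ℝ) < 2)),
    hnk.eventually_gt_atTop 0, hm.eventually hCs,
    hnR.eventually (eventually_le_partialSum hφ (law_nonneg hlaw)),
    hnR.eventually (eventually_tail_sub hφ (hG.tail_sub_tail hlaw)),
    hkφ.eventually_gt_atTop (32 * C), hnR.eventually_gt_atTop 0] with j h1 h2 h3 h4 h5 h6 h7
  simp only [Pi.div_apply, Function.comp] at h1 h3
  set m := (n j : ℝ) / k j * φs ((n j : ℝ) / k j) with hmdef
  rw [div_le_iff₀ h2] at h1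
  have hk : (0 : ℝ) < k j := by
    rcases (Nat.cast_nonneg (α := ℝ) (k j)).eq_or_lt with h | h
    · rw [← h, div_zero] at h2; exact absurd h2 (lt_irrefl _)
    · exact h
  rcases le_total m (n j) with hmn | hmn
  · have h8 : φ (n j) / 8 ≤ r m := by
      have : r (n j) ≤ r m := tail_anti hmn
      linarith [h5.1, tail_nonneg (P := P) (G := G) (2 * n j)]
    have := mul_le_mul_of_nonneg_left h8 hk.le
    linarith
  · exfalso
    have h8 := partialSum_mono (law_nonneg hlaw) hmn
    have h9 : (n j : ℝ) * φ (n j) / 16 ≤ C * (2 * (n j / k j)) :=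
      h4.trans (h8.trans (h3.trans (mul_le_mul_of_nonneg_left h1 hC.le)))
    have h10 := mul_le_mul_of_nonneg_left h9 hk.le
    have e : (k j : ℝ) * (C * (2 * (n j / k j))) = 2 * C * n j := by field_simp
    rw [e] at h10
    have h11 := mul_lt_mul_of_pos_right h6 h7
    linarith

theorem exists_prob_eq_exp (hG : IsRecurrentGapSequence P G) (hφ : SlowlyVarying φ)
    (hlaw : ∀ n : ℕ, 1 ≤ n → P.real {ω | renewalTime G 1 ω = n} = φ n / n)
    {φs : ℝ → ℝ} (hφs : IsDeBruijnConjugate φs φ) {k n : ℕ → ℕ}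
    (hk : Tendsto k atTop atTop) (hn : Tendsto n atTop atTop)
    (hkφ : Tendsto (fun j => (k j : ℝ) * φ (n j)) atTop atTop)
    (hnk : Tendsto (fun j => (n j : ℝ) / k j) atTop atTop) :
    ∃ ε : ℕ → ℝ, Tendsto ε atTop (𝓝 0) ∧
      ∀ᶠ j in atTop, P.real {ω | renewalTime G (k j) ω ≤ n j} =
        Real.exp (-((1 + ε j) *
          (k j * renewalTail P G ((n j : ℝ) / k j * φs ((n j : ℝ) / k j))))) := by
  set X : ℕ → ℝ := fun j =>
    k j * renewalTail P G ((n j : ℝ) / k j * φs ((n j : ℝ) / k j)) with hX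
  have hXt : Tendsto X atTop atTop := hG.tendsto_mul_tail_conjugate hφ hlaw hφs hn hkφ hnk
  set p : ℕ → ℝ := fun j => P.real {ω | renewalTime G (k j) ω ≤ n j} with hp
  have hbd : ∀ δ : ℝ, 0 < δ → δ ≤ 1 → ∀ᶠ j in atTop,
      1 / 2 * Real.exp (-((1 + δ) * X j)) ≤ p j ∧ p j ≤ Real.exp (-((1 - δ) * X j)) := by
    intro δ hδ hδ1
    filter_upwards [hnk.eventually (hG.eventually_prob_bounds hφ hlaw hφs hδ hδ1),
      hk.eventually_gt_atTop 0] with j h1 h2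
    have h3 := h1 (k j)
    have hk0 : (k j : ℝ) ≠ 0 := by positivity
    rw [div_mul_cancel₀ _ hk0] at h3
    simpa only [Nat.cast_le] using h3
  refine ⟨fun j => -Real.log (p j) / X j - 1, ?_, ?_⟩
  · rw [Metric.tendsto_atTop']
    intro η hη
    have hlog : Tendsto (fun j => Real.log 2 / X j) atTop (𝓝 0) := hXt.const_div_atTop _
    have hδ : 0 < min (η / 2) 1 := lt_min (by linarith) one_pos
    have hδη : min (η / 2) 1 ≤ η / 2 := min_le_left _ _
    obtain ⟨N, hN⟩ := eventually_atTop.1 (((hbd _ hδ (min_le_right _ _)).and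
      (hlog.eventually_lt_const (half_pos hη))).and (hXt.eventually_gt_atTop 0))
    refine ⟨N, fun j hj => ?_⟩
    obtain ⟨⟨⟨h1, h2⟩, h3⟩, h4⟩ := hN j hj.le
    set δ := min (η / 2) 1 with hδdef
    have hp0 : 0 < p j := lt_of_lt_of_le (by positivity) h1
    have h5 := Real.log_le_log (by positivity) h1
    rw [Real.log_mul (by norm_num) (Real.exp_pos _).ne', Real.log_exp, one_div,
      Real.log_inv] at h5
    have h6 := Real.log_le_log hp0 h2
    rw [Real.log_exp] at h6
    rw [div_lt_iff₀ h4] at h3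
    rw [Real.dist_eq, sub_zero, abs_lt]
    have h7 : δ * X j ≤ η / 2 * X j := mul_le_mul_of_nonneg_right hδη h4.le
    have h8 : 0 < η / 2 * X j := by positivity
    constructor
    · rw [lt_sub_iff_add_lt, lt_div_iff₀ h4]
      linarith
    · rw [sub_lt_iff_lt_add, div_lt_iff₀ h4]
      linarith
  · filter_upwards [hbd 1 one_pos le_rfl, hXt.eventually_gt_atTop 0] with j h1 h2
    have hp0 : 0 < p j := lt_of_lt_of_le (by positivity) h1.1
    have : -((1 + (-Real.log (p j) / X j - 1)) * X j) = Real.log (p j) := by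
      field_simp
      ring
    rw [this, Real.exp_log hp0]

/-- Fekete's lemma for `k ↦ -log P(τ_k ≤ b k)`. -/
theorem exists_tendsto_neg_log_prob_div (hG : IsRecurrentGapSequence P G) {b : ℝ}
    (hb : 0 < P.real {ω | (renewalTime G 1 ω : ℝ) ≤ b}) :
    (∀ k : ℕ, 0 < P.real {ω | (renewalTime G k ω : ℝ) ≤ b * k}) ∧
    ∃ L : ℝ, Tendsto (fun k : ℕ => -Real.log (P.real {ω | (renewalTime G k ω : ℝ) ≤ b * k}) / k)
      atTop (𝓝 L) := by
  have hpos : ∀ k : ℕ, 0 < P.real {ω | (renewalTime G k ω : ℝ) ≤ b * k} := by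
    intro k
    induction k with
    | zero => simp [renewalTime]
    | succ k ih =>
      refine (mul_pos ih hb).trans_le ?_
      have := hG.prob_mul_le k 1 (b * k) b
      rwa [show b * k + b = b * (k + 1 : ℕ) by push_cast; ring] at this
  have hsub : Subadditive fun k : ℕ =>
      -Real.log (P.real {ω | (renewalTime G k ω : ℝ) ≤ b * k}) := by
    intro k l
    have h := hG.prob_mul_le k l (b * k) (b * l)
    rw [← mul_add, ← Nat.cast_add] at h
    have := Real.log_le_log (mul_pos (hpos k) (hpos l)) h
    rw [Real.log_mul (hpos k).ne' (hpos l).ne'] at this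
    linarith
  refine ⟨hpos, hsub.lim, hsub.tendsto_lim ⟨0, ?_⟩⟩
  rintro _ ⟨k, rfl⟩
  exact div_nonneg (neg_nonneg.2 (Real.log_nonpos measureReal_nonneg measureReal_le_one))
    (Nat.cast_nonneg k)

omit [IsProbabilityMeasure P] in
theorem prob_eq_zero (hG : IsRecurrentGapSequence P G) {d : ℕ}
    (hd : ∀ j < d, P {ω | renewalTime G 1 ω = j} = 0) {b : ℝ} (hb : b < d) {k : ℕ} (hk : 0 < k) :
    P {ω | (renewalTime G k ω : ℝ) ≤ b * k} = 0 := by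
  have h0 : ∀ i, P {ω | G i ω < d} = 0 := by
    intro i
    have h1 : P {ω | G i ω < d} = P {ω | G 0 ω < d} :=
      (hG.identDistrib i).measure_mem_eq (s := Set.Iio d) MeasurableSet.of_discrete
    have h2 : {ω | G 0 ω < d} = ⋃ j ∈ Set.Iio d, {ω | G 0 ω = j} := by
      ext ω; simp
    rw [h1, h2, measure_biUnion_null_iff (Set.to_countable _)]
    intro j hj
    have := hd j hj
    rwa [renewalTime_one] at this
  refine measure_mono_null (fun ω (hω : (renewalTime G k ω : ℝ) ≤ b * k) => ?_)
    (measure_iUnion_null h0)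
  by_contra hcon
  simp only [Set.mem_iUnion, not_exists, Set.mem_ofPred_eq, not_lt] at hcon
  have h1 := Finset.card_nsmul_le_sum (Finset.range k) (fun i => G i ω) d fun i _ => hcon i
  rw [Finset.card_range, nsmul_eq_mul] at h1
  have h2 : (k : ℝ) * d ≤ renewalTime G k ω := by exact_mod_cast h1
  have hk0 : (0 : ℝ) < k := by exact_mod_cast hk
  have := mul_lt_mul_of_pos_right hb hk0
  linarith

/-- The rate function: a finite limit from Fekete's lemma if `b` is at least the least value of a
gap, and `⊤` below it, where the probabilities vanish. -/
theorem exists_rate (hG : IsRecurrentGapSequence P G) (hφ : SlowlyVarying φ)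
    (hlaw : ∀ n : ℕ, 1 ≤ n → P.real {ω | renewalTime G 1 ω = n} = φ n / n) :
    ∃ I : ℝ → EReal,
      (∀ b : ℝ, Tendsto
        (fun k : ℕ => ENNReal.log (P {ω | (renewalTime G k ω : ℝ) ≤ b * k}) / (k : EReal))
          atTop (𝓝 (-(I b)))) ∧
      ∀ b : ℝ, ((sInf {j : ℕ | 0 < P {ω | renewalTime G 1 ω = j}} : ℕ) : ℝ) ≤ b →
        ∃ L : ℝ, I b = L ∧ (∀ k : ℕ, 0 < P.real {ω | (renewalTime G k ω : ℝ) ≤ b * k}) ∧ Tendsto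
          (fun k : ℕ => -Real.log (P.real {ω | (renewalTime G k ω : ℝ) ≤ b * k}) / k)
          atTop (𝓝 L) := by
  set d := sInf {j : ℕ | 0 < P {ω | renewalTime G 1 ω = j}} with hd
  have hdmem : 0 < P {ω | renewalTime G 1 ω = d} := by
    refine Nat.sInf_mem (s := {j : ℕ | 0 < P {ω | renewalTime G 1 ω = j}}) ?_
    obtain ⟨j, hj, hj1⟩ := ((tendsto_natCast_atTop_atTop.eventually hφ.eventually_pos).and
      (eventually_ge_atTop 1)).exists
    refine ⟨j, pos_iff_ne_zero.2 (fun h => ?_ : P {ω | renewalTime G 1 ω = j} ≠ 0)⟩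
    have hj0 : (0 : ℝ) < j := by exact_mod_cast hj1
    have := hlaw j hj1
    rw [measureReal_def, h, ENNReal.toReal_zero] at this
    exact (div_pos hj hj0).ne this
  have key : ∀ b : ℝ, ∃ I : EReal, Tendsto
        (fun k : ℕ => ENNReal.log (P {ω | (renewalTime G k ω : ℝ) ≤ b * k}) / (k : EReal))
          atTop (𝓝 (-I)) ∧ ((d : ℝ) ≤ b → ∃ L : ℝ, I = L ∧
          (∀ k : ℕ, 0 < P.real {ω | (renewalTime G k ω : ℝ) ≤ b * k}) ∧ Tendsto
          (fun k : ℕ => -Real.log (P.real {ω | (renewalTime G k ω : ℝ) ≤ b * k}) / k)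
          atTop (𝓝 L)) := by
    intro b
    rcases le_or_gt (d : ℝ) b with hb | hb
    · have hpos : 0 < P.real {ω | (renewalTime G 1 ω : ℝ) ≤ b} := by
        refine lt_of_lt_of_le (ENNReal.toReal_pos hdmem.ne' (measure_ne_top _ _))
          (measureReal_mono fun ω (hω : _ = d) => ?_)
        rw [Set.mem_ofPred_eq, hω]
        exact hb
      obtain ⟨hp, L, hL⟩ := hG.exists_tendsto_neg_log_prob_div hpos
      refine ⟨L, ?_, fun _ => ⟨L, rfl, hp, hL⟩⟩
      have hL' := (continuous_coe_real_ereal.tendsto _).comp hL.neg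
      rw [EReal.coe_neg] at hL'
      refine hL'.congr' ?_
      filter_upwards with k
      simp only [Function.comp]
      rw [ENNReal.log_pos_real' (hp k), neg_div, neg_neg, EReal.coe_div]
      rfl
    · refine ⟨⊤, ?_, fun h => absurd h (not_le.2 hb)⟩
      rw [EReal.neg_top]
      refine tendsto_const_nhds.congr' ?_
      filter_upwards [eventually_gt_atTop 0] with k hk
      have hd0 : ∀ j < d, P {ω | renewalTime G 1 ω = j} = 0 := fun j hj =>
        nonpos_iff_eq_zero.1 (not_lt.1 (Nat.notMem_of_lt_sInf hj))
      rw [hG.prob_eq_zero hd0 hb hk, ENNReal.log_zero, EReal.bot_div_of_pos_ne_top]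
      · exact_mod_cast hk
      · exact EReal.natCast_ne_top k
  choose I hI using key
  exact ⟨I, fun b => (hI b).1, fun b => (hI b).2⟩

/-- The factor `1 / 2` contributes `log 2 / k` to the normalised logarithm, and disappears in the
limit. -/
theorem abs_rate_sub_le {L r δ : ℝ} {p : ℕ → ℝ} (hp : ∀ k, 0 < p k)
    (hL : Tendsto (fun k : ℕ => -Real.log (p k) / k) atTop (𝓝 L))
    (h : ∀ k : ℕ, 1 / 2 * Real.exp (-((1 + δ) * (k * r))) ≤ p k ∧
      p k ≤ Real.exp (-((1 - δ) * (k * r)))) :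
    |L - r| ≤ δ * r := by
  have hlog : Tendsto (fun k : ℕ => (1 + δ) * r + Real.log 2 / k) atTop (𝓝 ((1 + δ) * r)) := by
    simpa using (tendsto_natCast_atTop_atTop.const_div_atTop (Real.log 2)).const_add ((1 + δ) * r)
  have h1 : L ≤ (1 + δ) * r := by
    refine le_of_tendsto_of_tendsto hL hlog ?_
    filter_upwards [eventually_gt_atTop 0] with k hk
    have hk0 : (0 : ℝ) < k := by exact_mod_cast hk
    have h5 := Real.log_le_log (by positivity) (h k).1
    rw [Real.log_mul (by norm_num) (Real.exp_pos _).ne', Real.log_exp, one_div,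
      Real.log_inv] at h5
    rw [div_le_iff₀ hk0, add_mul, div_mul_cancel₀ _ hk0.ne']
    linarith
  have h2 : (1 - δ) * r ≤ L := by
    refine ge_of_tendsto hL ?_
    filter_upwards [eventually_gt_atTop 0] with k hk
    have hk0 : (0 : ℝ) < k := by exact_mod_cast hk
    have h6 := Real.log_le_log (hp k) (h k).2
    rw [Real.log_exp] at h6
    rw [le_div_iff₀ hk0]
    linarith
  rw [abs_le]
  constructor <;> linarith

end IsRecurrentGapSequence

theorem theorem2 {Ω : Type*} [MeasurableSpace Ω] (P : Measure Ω) [IsProbabilityMeasure P]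
    (G : ℕ → Ω → ℕ) (hG : IsRecurrentGapSequence P G)
    (φ : ℝ → ℝ) (hφ : SlowlyVarying φ)
    (hlaw : ∀ n : ℕ, 1 ≤ n → P.real {ω | renewalTime G 1 ω = n} = φ n / n) :
    -- (i)
    (∃ a : ℝ → ℝ, (∀ M : ℝ, 0 < M → 0 < a M) ∧ Tendsto a (𝓝[>] 0) (𝓝 1) ∧
      ∀ M : ℝ, 0 < M → ∃ N : ℕ, ∀ n k : ℕ, N ≤ n → k ≤ n → (k : ℝ) * φ n ≤ M →
        a M * (1 - renewalTail P G n) ^ k ≤ P.real {ω | renewalTime G k ω ≤ n} ∧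
        P.real {ω | renewalTime G k ω ≤ n} ≤ (1 - renewalTail P G n) ^ k) ∧
    -- (ii)
    (∀ φs : ℝ → ℝ, IsDeBruijnConjugate φs φ →
      ∀ k n : ℕ → ℕ, Tendsto k atTop atTop → Tendsto n atTop atTop →
        Tendsto (fun j => (k j : ℝ) * φ (n j)) atTop atTop →
        Tendsto (fun j => (n j : ℝ) / k j) atTop atTop →
        ∃ ε : ℕ → ℝ, Tendsto ε atTop (𝓝 0) ∧
          ∀ᶠ j in atTop, P.real {ω | renewalTime G (k j) ω ≤ n j} =
            Real.exp (-((1 + ε j) *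
              (k j * renewalTail P G ((n j : ℝ) / k j * φs ((n j : ℝ) / k j)))))) ∧
    -- (iii)
    (∃ I : ℝ → EReal,
      (∀ b : ℝ, 1 ≤ b →
        Tendsto (fun k : ℕ => ENNReal.log (P {ω | (renewalTime G k ω : ℝ) ≤ b * k}) / (k : EReal))
          atTop (𝓝 (-(I b)))) ∧
      (∀ b : ℝ, 1 ≤ b → ((sInf {j : ℕ | 0 < P {ω | renewalTime G 1 ω = j}} : ℕ) : ℝ) ≤ b →
        I b ≠ ⊤ ∧ I b ≠ ⊥) ∧
      ∀ φs : ℝ → ℝ, IsDeBruijnConjugate φs φ →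
        (fun b => (I b).toReal) ~[atTop] (fun b => renewalTail P G (b * φs b))) := by
  refine ⟨hG.exists_const_mul_le_prob hφ hlaw,
    fun φs hφs k n hk hn hkφ hnk => hG.exists_prob_eq_exp hφ hlaw hφs hk hn hkφ hnk, ?_⟩
  obtain ⟨I, hI, hfin⟩ := hG.exists_rate hφ hlaw
  refine ⟨I, fun b _ => hI b, fun b _ hb => ?_, fun φs hφs => ?_⟩
  · obtain ⟨L, hL, -⟩ := hfin b hb
    rw [hL]
    exact ⟨EReal.coe_ne_top L, EReal.coe_ne_bot L⟩
  · refine isLittleO_iff.2 fun c hc => ?_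
    have hδ : 0 < min c 1 := lt_min hc one_pos
    filter_upwards [hG.eventually_prob_bounds hφ hlaw hφs hδ (min_le_right _ _),
      eventually_ge_atTop ((sInf {j : ℕ | 0 < P {ω | renewalTime G 1 ω = j}} : ℕ) : ℝ)]
      with b h1 h2
    obtain ⟨L, hL, hp, hlim⟩ := hfin b h2
    have h3 := IsRecurrentGapSequence.abs_rate_sub_le hp hlim h1
    rw [Pi.sub_apply, hL, EReal.toReal_coe, Real.norm_eq_abs, Real.norm_eq_abs,
      abs_of_nonneg (IsRecurrentGapSequence.tail_nonneg (P := P) (G := G) _)]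
    exact h3.trans (mul_le_mul_of_nonneg_right (min_le_left _ _)
      (IsRecurrentGapSequence.tail_nonneg _))
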